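/- Let $n\ge 2$ and $i\ge 2$ be integers. Let $A_n=\mathbb C\langle x_1,\dots,x_n\rangle$ be the free associative algebra, regarded as the universal enveloping algebra $U(\ell_n)$ of the free Lie algebra $\ell_n$ on $x_1,\dots,x_n$. The Lie filtration on $A_n$ is the increasing filtration in which $\ell_n$ sits in degree $1$: $F_mA_n$ is the span of all products of at most $m$ elements of $\ell_n$ (with $F_0A_n=\mathbb C$). For an algebra $A$ put $L_1(A)=A$, $L_{j+1}(A)=[A,L_j(A)]$, let $M_j(A)$ be the two-sided ideal of $A$ generated by $L_j(A)$, and let $Q_{n,i}=A_n/M_i(A_n)$. Give $Q_{n,i}$ the filtration by the images of the $F_mA_n$, and let $D_{n,i}=\operatorname{gr}Q_{n,i}=\bigoplus_{m\ge 0}F_mQ_{n,i}/F_{m-1}Q_{n,i}$ (with $F_{-1}=0$), a commutative algebra. The linear map $\ell_n\to F_1Q_{n,i}/F_0Q_{n,i}\subset D_{n,i}$ induces an algebra homomorphism $\operatorname{Sym}\ell_n\to D_{n,i}$. Let $\ell_n'=[\ell_n,\ell_n]$, let $\Lambda_{n,i}\subset D_{n,i}$ be the image of $\operatorname{Sym}\ell_n'$,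 and let $$\theta:\mathbb C[x_1,\dots,x_n]\otimes\Lambda_{n,i}\to D_{n,i}$$ be the multiplication map, where $x_j$ is sent to its class in $F_1Q_{n,i}/F_0Q_{n,i}$. For $d\ge 0$ let $D_{n,i}[d]$ be the span of the classes in $F_mQ_{n,i}/F_{m-1}Q_{n,i}$, $m\ge0$, of those elements of $F_mA_n$ that are homogeneous of degree $d$ for the grading of $A_n$ with $\deg x_j=1$, and put $\Lambda_{n,i}[d]=\Lambda_{n,i}\cap D_{n,i}[d]$. Then: (i) $\Lambda_{n,i}$ is a finite-dimensional algebra, the subspaces $\Lambda_{n,i}[d]$, $d\ge 0$, form an algebra grading $\Lambda_{n,i}=\bigoplus_{d\ge 0}\Lambda_{n,i}[d]$, and $\Lambda_{n,i}[0]=\mathbb C$ (that is, $\mathbb C\to\Lambda_{n,i}$ is injective with image $\Lambda_{n,i}[0]$). (ii) The map $\theta$ is an isomorphism of algebras. -/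

import Mathlib

noncomputable section

namespace LieNilp

attribute [local instance] LieRing.ofAssociativeRing

/-! ### The associated graded algebra of an almost commutative filtration -/

section Filtration

universe u v w

variable (R : Type u) (A : Type v) [CommRing R] [Ring A] [Algebra R A]

/-- The term just below `F m` in an increasing filtration indexed by `ℕ`:
`F (m - 1)` if `1 ≤ m`, and `0` if `m = 0`. -/
def below {R : Type u} {A : Type v} [CommRing R] [Ring A] [Algebra R A]
    (F : ℕ → Submodule R A) : ℕ → Submodule R A
  | 0 => ⊥
  | m + 1 => F m

/-- An increasing multiplicative filtration `F 0 ≤ F 1 ≤ F 2 ≤ ⋯` on an `R`-algebra `A`, such that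
`[F i, F j] ⊆ F (i + j - 1)`, so that the associated graded algebra is commutative. -/
structure ACFiltration where
  F : ℕ → Submodule R A
  mono : Monotone F
  one_mem : (1 : A) ∈ F 0
  mul_mem : ∀ {i j : ℕ} {a b : A}, a ∈ F i → b ∈ F j → a * b ∈ F (i + j)
  comm_mem : ∀ {i j : ℕ} {a b : A}, a ∈ F i → b ∈ F j → a * b - b * a ∈ below F (i + j)

namespace ACFiltration

variable {R A}
variable (𝓕 : ACFiltration R A)

lemma mul_below_left {i j : ℕ} {a b : A} (ha : a ∈ below 𝓕.F i) (hb : b ∈ 𝓕.F j) :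
    a * b ∈ below 𝓕.F (i + j) := by
  cases i with
  | zero =>
    have h0 : a = 0 := by simpa [below] using ha
    rw [h0, zero_mul]
    exact Submodule.zero_mem _
  | succ i =>
    rw [Nat.succ_add_eq_add_succ, Nat.add_succ]
    exact 𝓕.mul_mem ha hb

lemma mul_below_right {i j : ℕ} {a b : A} (ha : a ∈ 𝓕.F i) (hb : b ∈ below 𝓕.F j) :
    a * b ∈ below 𝓕.F (i + j) := by
  cases j with
  | zero =>
    have h0 : b = 0 := by simpa [below] using hb
    rw [h0, mul_zero]
    exact Submodule.zero_mem _
  | succ j => exact 𝓕.mul_mem ha hb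

/-- The `m`-th graded piece `F m / F (m - 1)`. -/
abbrev grPiece (m : ℕ) : Type v :=
  ↥(𝓕.F m) ⧸ (below 𝓕.F m).comap (𝓕.F m).subtype

/-- The class of an element of `F m` in `F m / F (m - 1)`. -/
def cls (m : ℕ) : ↥(𝓕.F m) →ₗ[R] 𝓕.grPiece m :=
  ((below 𝓕.F m).comap (𝓕.F m).subtype).mkQ

lemma cls_surj (m : ℕ) (y : 𝓕.grPiece m) : ∃ a : ↥(𝓕.F m), 𝓕.cls m a = y :=
  Submodule.mkQ_surjective _ y

lemma cls_eq {m : ℕ} {a b : ↥(𝓕.F m)} :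
    𝓕.cls m a = 𝓕.cls m b ↔ (a : A) - b ∈ below 𝓕.F m :=
  Submodule.Quotient.eq _

/-- The product of graded pieces, induced by the product of `A`. -/
def grMul {i j : ℕ} (x : 𝓕.grPiece i) (y : 𝓕.grPiece j) : 𝓕.grPiece (i + j) :=
  Quotient.liftOn₂' x y
    (fun a b => 𝓕.cls (i + j) ⟨(a : A) * b, 𝓕.mul_mem a.2 b.2⟩)
    (by
      intro a b a' b' ha hb
      rw [Submodule.quotientRel_def] at ha hb
      rw [cls_eq]
      have e : (a : A) * b - a' * b' = (a - a') * b + a' * (b - b') := by noncomm_ring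
      show (a : A) * b - a' * b' ∈ _
      rw [e]
      exact Submodule.add_mem _ (𝓕.mul_below_left ha b.2) (𝓕.mul_below_right a'.2 hb))

lemma grMul_cls {i j : ℕ} (a : ↥(𝓕.F i)) (b : ↥(𝓕.F j)) :
    𝓕.grMul (𝓕.cls i a) (𝓕.cls j b) = 𝓕.cls (i + j) ⟨(a : A) * b, 𝓕.mul_mem a.2 b.2⟩ :=
  rfl

/-- The unit of the associated graded algebra. -/
def grOne : 𝓕.grPiece 0 := 𝓕.cls 0 ⟨1, 𝓕.one_mem⟩

instance : GradedMonoid.GMul 𝓕.grPiece := ⟨fun x y => 𝓕.grMul x y⟩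

instance : GradedMonoid.GOne 𝓕.grPiece := ⟨𝓕.grOne⟩

lemma gmul_cls {i j : ℕ} (a : ↥(𝓕.F i)) (b : ↥(𝓕.F j)) :
    (GradedMonoid.GMul.mul (𝓕.cls i a) (𝓕.cls j b) : 𝓕.grPiece (i + j)) =
      𝓕.cls (i + j) ⟨(a : A) * b, 𝓕.mul_mem a.2 b.2⟩ :=
  rfl

lemma gone_eq : (GradedMonoid.GOne.one : 𝓕.grPiece 0) = 𝓕.cls 0 ⟨1, 𝓕.one_mem⟩ := rfl

lemma mk_cls_eq {m m' : ℕ} (h : m = m') {a : ↥(𝓕.F m)} {b : ↥(𝓕.F m')}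
    (hab : (a : A) - b ∈ below 𝓕.F m) :
    (GradedMonoid.mk m (𝓕.cls m a) : GradedMonoid 𝓕.grPiece) =
      GradedMonoid.mk m' (𝓕.cls m' b) := by
  subst h
  rw [(𝓕.cls_eq).2 hab]

lemma mk_cls_eq' {m m' : ℕ} (h : m = m') {a : ↥(𝓕.F m)} {b : ↥(𝓕.F m')}
    (hab : (a : A) = b) :
    (GradedMonoid.mk m (𝓕.cls m a) : GradedMonoid 𝓕.grPiece) =
      GradedMonoid.mk m' (𝓕.cls m' b) :=
  𝓕.mk_cls_eq h (by rw [hab, sub_self]; exact Submodule.zero_mem _)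

lemma algebraMap_mem (r : R) : algebraMap R A r ∈ 𝓕.F 0 := by
  rw [Algebra.algebraMap_eq_smul_one]
  exact Submodule.smul_mem _ _ 𝓕.one_mem

instance : DirectSum.GCommRing 𝓕.grPiece where
  mul_zero {i j} x := by
    obtain ⟨a, rfl⟩ := 𝓕.cls_surj i x
    rw [← map_zero (𝓕.cls j), ← map_zero (𝓕.cls (i + j)), gmul_cls, cls_eq]
    simp
  zero_mul {i j} y := by
    obtain ⟨b, rfl⟩ := 𝓕.cls_surj j y
    rw [← map_zero (𝓕.cls i), ← map_zero (𝓕.cls (i + j)), gmul_cls, cls_eq]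
    simp
  mul_add {i j} x y z := by
    obtain ⟨a, rfl⟩ := 𝓕.cls_surj i x
    obtain ⟨b, rfl⟩ := 𝓕.cls_surj j y
    obtain ⟨c, rfl⟩ := 𝓕.cls_surj j z
    rw [← map_add (𝓕.cls j), gmul_cls, gmul_cls, gmul_cls, ← map_add, cls_eq]
    simp [mul_add]
  add_mul {i j} x y z := by
    obtain ⟨a, rfl⟩ := 𝓕.cls_surj i x
    obtain ⟨b, rfl⟩ := 𝓕.cls_surj i y
    obtain ⟨c, rfl⟩ := 𝓕.cls_surj j z
    rw [← map_add (𝓕.cls i), gmul_cls, gmul_cls, gmul_cls, ← map_add, cls_eq]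
    simp [add_mul]
  one_mul := by
    rintro ⟨i, x⟩
    obtain ⟨a, rfl⟩ := 𝓕.cls_surj i x
    exact 𝓕.mk_cls_eq' (zero_add i) (one_mul _)
  mul_one := by
    rintro ⟨i, x⟩
    obtain ⟨a, rfl⟩ := 𝓕.cls_surj i x
    exact 𝓕.mk_cls_eq' (add_zero i) (mul_one _)
  mul_assoc := by
    rintro ⟨i, x⟩ ⟨j, y⟩ ⟨k, z⟩
    obtain ⟨a, rfl⟩ := 𝓕.cls_surj i x
    obtain ⟨b, rfl⟩ := 𝓕.cls_surj j y
    obtain ⟨c, rfl⟩ := 𝓕.cls_surj k z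
    exact 𝓕.mk_cls_eq' (add_assoc i j k) (mul_assoc _ _ _)
  natCast m := 𝓕.cls 0 ⟨(m : A), by simpa using 𝓕.algebraMap_mem (m : R)⟩
  natCast_zero := by
    rw [← map_zero (𝓕.cls 0), cls_eq]
    simp
  natCast_succ m := by
    rw [gone_eq, ← map_add, cls_eq]
    simp
  intCast m := 𝓕.cls 0 ⟨(m : A), by simpa using 𝓕.algebraMap_mem (m : R)⟩
  intCast_ofNat m := by
    rw [cls_eq]
    simp
  intCast_negSucc_ofNat m := by
    rw [← map_neg, cls_eq]
    simp
  mul_comm := by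
    rintro ⟨i, x⟩ ⟨j, y⟩
    obtain ⟨a, rfl⟩ := 𝓕.cls_surj i x
    obtain ⟨b, rfl⟩ := 𝓕.cls_surj j y
    exact 𝓕.mk_cls_eq (add_comm i j) (𝓕.comm_mem a.2 b.2)

instance : DirectSum.GAlgebra R 𝓕.grPiece where
  toFun :=
    { toFun := fun r => 𝓕.cls 0 ⟨algebraMap R A r, 𝓕.algebraMap_mem r⟩
      map_zero' := by
        rw [← map_zero (𝓕.cls 0), cls_eq]
        simp
      map_add' := fun r s => by
        rw [← map_add, cls_eq]
        simp }
  map_one := by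
    refine (𝓕.cls_eq).2 ?_
    simp
  map_mul r s := 𝓕.mk_cls_eq' (zero_add 0).symm (map_mul (algebraMap R A) r s)
  commutes := by
    rintro r ⟨i, x⟩
    obtain ⟨a, rfl⟩ := 𝓕.cls_surj i x
    exact 𝓕.mk_cls_eq' ((zero_add i).trans (add_zero i).symm) (Algebra.commutes r (a : A))
  smul_def := by
    rintro r ⟨i, x⟩
    obtain ⟨a, rfl⟩ := 𝓕.cls_surj i x
    exact 𝓕.mk_cls_eq' (zero_add i).symm (Algebra.smul_def r (a : A))

/-- The associated graded algebra `⨁ m, F m / F (m - 1)`, a commutative `R`-algebra. -/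
def Gr : Type v := DirectSum ℕ 𝓕.grPiece

instance : CommRing 𝓕.Gr := inferInstanceAs (CommRing (DirectSum ℕ 𝓕.grPiece))

instance : Algebra R 𝓕.Gr := inferInstanceAs (Algebra R (DirectSum ℕ 𝓕.grPiece))

/-- The symbol map `F m → F m / F (m - 1) ⊆ Gr`. -/
def symbol (m : ℕ) : ↥(𝓕.F m) →ₗ[R] 𝓕.Gr where
  toFun a := (DirectSum.of 𝓕.grPiece m (𝓕.cls m a) : DirectSum ℕ 𝓕.grPiece)
  map_add' a b := by
    rw [map_add]
    exact map_add (DirectSum.of 𝓕.grPiece m) _ _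
  map_smul' r a := by
    rw [map_smul]
    exact (DirectSum.lof R ℕ 𝓕.grPiece m).map_smul r (𝓕.cls m a)

/-- The filtration on `B` given by the images of the terms of a filtration on `A` under an algebra
homomorphism `A → B` (in the application: onto a quotient of `A`). -/
def map {B : Type w} [Ring B] [Algebra R B] (φ : A →ₐ[R] B) : ACFiltration R B where
  F m := (𝓕.F m).map φ.toLinearMap
  mono _ _ h := Submodule.map_mono (𝓕.mono h)
  one_mem := ⟨1, 𝓕.one_mem, map_one φ⟩
  mul_mem := by
    rintro i j _ _ ⟨a, ha, rfl⟩ ⟨b, hb, rfl⟩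
    exact ⟨a * b, 𝓕.mul_mem ha hb, map_mul φ a b⟩
  comm_mem := by
    rintro i j _ _ ⟨a, ha, rfl⟩ ⟨b, hb, rfl⟩
    have key : ∀ (m : ℕ) (c : A), c ∈ below 𝓕.F m →
        φ c ∈ below (fun m => (𝓕.F m).map φ.toLinearMap) m := by
      intro m c hc
      cases m with
      | zero =>
        have h0 : c = 0 := by simpa [below] using hc
        rw [h0, map_zero]
        exact Submodule.zero_mem _
      | succ m => exact ⟨c, hc, rfl⟩
    have := key _ _ (𝓕.comm_mem ha hb)
    simpa using this

end ACFiltration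

/-- Commutators in the powers of `V = R + g`, where `g` is closed under commutators. -/
lemma commutator_pow {R : Type u} {A : Type v} [CommRing R] [Ring A] [Algebra R A]
    (V : Submodule R A) (h1 : (1 : A) ∈ V) (hV : ∀ a ∈ V, ∀ b ∈ V, a * b - b * a ∈ V)
    (i j : ℕ) : ∀ a ∈ V ^ i, ∀ b ∈ V ^ j, a * b - b * a ∈ below (fun m => V ^ m) (i + j) := by
  have one_le : (1 : Submodule R A) ≤ V := Submodule.one_le.2 h1
  -- first with `b ∈ V`
  have step : ∀ (i : ℕ), ∀ a ∈ V ^ i, ∀ b ∈ V, a * b - b * a ∈ V ^ i := by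
    intro i
    induction i with
    | zero =>
      intro a ha b hb
      rw [pow_zero] at ha ⊢
      obtain ⟨r, rfl⟩ := Submodule.mem_one.1 ha
      rw [Algebra.commutes, sub_self]
      exact Submodule.zero_mem _
    | succ i ih =>
      intro a ha b hb
      rw [pow_succ] at ha
      refine Submodule.mul_induction_on ha ?_ ?_
      · intro x hx y hy
        have e : x * y * b - b * (x * y) = x * (y * b - b * y) + (x * b - b * x) * y := by
          noncomm_ring
        rw [e, pow_succ]
        exact Submodule.add_mem _ (Submodule.mul_mem_mul hx (hV y hy b hb))
          (Submodule.mul_mem_mul (ih x hx b hb) hy)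
      · intro x y hx hy
        have e : (x + y) * b - b * (x + y) = (x * b - b * x) + (y * b - b * y) := by
          noncomm_ring
        rw [e]
        exact Submodule.add_mem _ hx hy
  induction j with
  | zero =>
    intro a _ b hb
    rw [pow_zero] at hb
    obtain ⟨r, rfl⟩ := Submodule.mem_one.1 hb
    rw [Algebra.commutes, sub_self]
    exact Submodule.zero_mem _
  | succ j ih =>
    intro a ha b hb
    rw [pow_succ] at hb
    show a * b - b * a ∈ V ^ (i + j)
    refine Submodule.mul_induction_on hb ?_ ?_
    · intro x hx y hy
      have e : a * (x * y) - x * y * a = (a * x - x * a) * y + x * (a * y - y * a) := by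
        noncomm_ring
      rw [e]
      refine Submodule.add_mem _ ?_ ?_
      · have h := ih a ha x hx
        revert h
        cases hk : i + j with
        | zero =>
          intro h
          have h0 : a * x - x * a = 0 := by simpa [below] using h
          rw [h0, zero_mul]
          exact Submodule.zero_mem _
        | succ k =>
          intro h
          rw [pow_succ]
          exact Submodule.mul_mem_mul h hy
      · rw [add_comm, pow_add]
        exact Submodule.mul_mem_mul hx (step i a ha y hy)
    · intro x y hx hy
      have e : a * (x + y) - (x + y) * a = (a * x - x * a) + (a * y - y * a) := by
        noncomm_ring
      rw [e]
      exact Submodule.add_mem _ hx hy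

/-- The Lie filtration on an associative algebra `A` defined by a Lie algebra homomorphism
`f : L → A`: the elements of `L` sit in degree `1`, i.e. `F m` is the span of the products of at
most `m` elements of the image of `L`. -/
def lieFiltration {R : Type u} {A : Type v} [CommRing R] [Ring A] [Algebra R A]
    {L : Type w} [LieRing L] [LieAlgebra R L] (f : L →ₗ⁅R⁆ A) : ACFiltration R A where
  F m := (1 ⊔ LinearMap.range (f : L →ₗ[R] A)) ^ m
  mono := fun a b h => pow_le_pow_right' le_sup_left h
  one_mem := by
    rw [pow_zero]
    exact Submodule.one_le.1 le_rfl
  mul_mem := by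
    intro i j a b ha hb
    rw [pow_add]
    exact Submodule.mul_mem_mul ha hb
  comm_mem := by
    intro i j a b ha hb
    refine commutator_pow _ (Submodule.one_le.1 le_sup_left) ?_ i j a ha b hb
    intro a ha b hb
    obtain ⟨r, hr, x, hx, rfl⟩ := Submodule.mem_sup.1 ha
    obtain ⟨s, hs, y, hy, rfl⟩ := Submodule.mem_sup.1 hb
    obtain ⟨r, rfl⟩ := Submodule.mem_one.1 hr
    obtain ⟨s, rfl⟩ := Submodule.mem_one.1 hs
    obtain ⟨x, rfl⟩ := hx
    obtain ⟨y, rfl⟩ := hy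
    refine Submodule.mem_sup_right ⟨⁅x, y⁆, ?_⟩
    have h1 := Algebra.commutes r (f y)
    have h2 := Algebra.commutes s (f x)
    have h3 := Algebra.commutes r (algebraMap R A s)
    simp only [LieHom.coe_toLinearMap, LieHom.map_lie, Ring.lie_def, add_mul, mul_add, h1, h2, h3]
    abel

/-- The two-sided ideal `M_i(A)` generated by the `i`-th term `L_i(A)` of the lower central series
of `A`, where `L_1(A) = A` and `L_{i+1}(A) = [A, L_i(A)]` (used for `i ≥ 1`; Mathlib's
`lowerCentralSeries` is indexed from `0`). -/
def lowerIdeal (i : ℕ) : Ideal A :=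
  (TwoSidedIdeal.span
    ((LieModule.lowerCentralSeries R A A (i - 1) : LieSubmodule R A A) : Set A)).asIdeal

instance (i : ℕ) : (lowerIdeal R A i).IsTwoSided := by
  unfold lowerIdeal
  infer_instance

end Filtration

/-! ### The algebras attached to the free algebra on `n` generators -/

/-- The free associative algebra `A_n` on `x_1, …, x_n`. -/
abbrev An (n : ℕ) : Type := FreeAlgebra ℂ (Fin n)

/-- The free Lie algebra `ℓ_n` on `x_1, …, x_n`. -/
abbrev elln (n : ℕ) : Type := FreeLieAlgebra ℂ (Fin n)

/-- The canonical map `ℓ_n → A_n = U(ℓ_n)`. -/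
def ellToA (n : ℕ) : elln n →ₗ⁅ℂ⁆ An n := FreeLieAlgebra.lift ℂ (FreeAlgebra.ι ℂ)

/-- The Lie filtration on `A_n`. -/
def filtA (n : ℕ) : ACFiltration ℂ (An n) := lieFiltration (ellToA n)

/-- The algebra `Q_{n,i} = A_n / M_i(A_n)`. -/
abbrev Q (n i : ℕ) : Type := An n ⧸ lowerIdeal ℂ (An n) i

/-- The projection `A_n → Q_{n,i}`. -/
def toQ (n i : ℕ) : An n →ₐ[ℂ] Q n i := Ideal.Quotient.mkₐ ℂ (lowerIdeal ℂ (An n) i)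

/-- The Lie filtration on `Q_{n,i}`, inherited from `A_n`. -/
def filtQ (n i : ℕ) : ACFiltration ℂ (Q n i) := (filtA n).map (toQ n i)

/-- The commutative algebra `D_{n,i} = gr Q_{n,i}`. -/
abbrev D (n i : ℕ) : Type := (filtQ n i).Gr

/-- The symbol in the `m`-th graded piece of `D_{n,i}` of the image in `Q_{n,i}` of an element of
the `m`-th term of the Lie filtration on `A_n`. -/
def symbolQ (n i m : ℕ) (a : An n) (ha : a ∈ (filtA n).F m) : D n i :=
  (filtQ n i).symbol m ⟨toQ n i a, a, ha, rfl⟩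

lemma ellToA_mem (n : ℕ) (y : elln n) : ellToA n y ∈ (filtA n).F 1 := by
  show _ ∈ (1 ⊔ LinearMap.range (ellToA n : elln n →ₗ[ℂ] An n)) ^ 1
  rw [pow_one]
  exact Submodule.mem_sup_right ⟨y, rfl⟩

/-- The linear map `ℓ_n → F 1 / F 0 ⊆ D_{n,i}` sending `y ∈ ℓ_n` to its symbol in filtration
degree `1`. -/
def ellToD (n i : ℕ) : elln n →ₗ[ℂ] D n i where
  toFun y := symbolQ n i 1 (ellToA n y) (ellToA_mem n y)
  map_add' y z := by
    unfold symbolQ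
    rw [← map_add]
    congr 1
    ext
    simp
  map_smul' r y := by
    unfold symbolQ
    rw [RingHom.id_apply, ← map_smul]
    congr 1
    ext
    simp

/-- The commutator subalgebra `ℓ_n' = [ℓ_n, ℓ_n]`. -/
def ellPrime (n : ℕ) : LieIdeal ℂ (elln n) := ⁅(⊤ : LieIdeal ℂ (elln n)), (⊤ : LieIdeal ℂ (elln n))⁆

/-- The natural algebra homomorphism `Sym ℓ_n' → D_{n,i}`. -/
def symPrimeToD (n i : ℕ) : SymmetricAlgebra ℂ (ellPrime n) →ₐ[ℂ] D n i :=
  SymmetricAlgebra.lift ((ellToD n i).comp (ellPrime n).toSubmodule.subtype)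

/-- The algebra `Λ_{n,i}`, the image of `Sym ℓ_n'` in `D_{n,i}`. -/
def Lam (n i : ℕ) : Subalgebra ℂ (D n i) := (symPrimeToD n i).range

/-- The multiplication map `θ : ℂ[x_1, …, x_n] ⊗ Λ_{n,i} → D_{n,i}`. -/
def theta (n i : ℕ) : TensorProduct ℂ (MvPolynomial (Fin n) ℂ) (Lam n i) →ₐ[ℂ] D n i :=
  Algebra.TensorProduct.productMap
    (MvPolynomial.aeval fun j => ellToD n i (FreeLieAlgebra.of ℂ j)) (Lam n i).val

/-- The homogeneous elements of degree `d` of `A_n`, with `deg x_j = 1`: the span of the words of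
length `d`. -/
def degA (n d : ℕ) : Submodule ℂ (An n) :=
  Submodule.span ℂ (Set.range (FreeAlgebra.ι ℂ : Fin n → An n)) ^ d

/-- The part of degree `d` of `D_{n,i}`, for the grading induced by `deg x_j = 1`: the span of the
symbols of the homogeneous elements of degree `d` of `A_n`. -/
def degD (n i d : ℕ) : Submodule ℂ (D n i) :=
  Submodule.span ℂ {y | ∃ (m : ℕ) (a : An n) (ha : a ∈ (filtA n).F m),
    a ∈ degA n d ∧ symbolQ n i m a ha = y}

/-- The part `Λ_{n,i}[d]` of degree `d` of `Λ_{n,i}`. -/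
def degLam (n i d : ℕ) : Submodule ℂ (Lam n i) :=
  (degD n i d).comap (Lam n i).val.toLinearMap

end LieNilp

end

noncomputable section

namespace LieNilp

attribute [local instance] LieRing.ofAssociativeRing

/-! ### Commutators are nilpotent modulo the lower central ideals -/

section LowerIdeal

variable {R A : Type*} [CommRing R] [Ring A] [Algebra R A]

/-! Finiteness of `Λ`. The image of `ℓ'` in `D` is finite-dimensional: the bracket of `k + 1`
elements of `ℓ` lies in `L_{k+1}(A)`, hence dies in `Q` once `k + 1 = i`, and the lower central
quotients of a finitely generated Lie algebra are finitely generated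
(`exists_fg_sup_lowerCentralSeries`). A finite spanning set can be chosen among the symbols of
brackets `[u, v]`. Each of these is nilpotent, because `[a, y]² M_{k+2} ⊆ M_{k+3}` in any algebra
over `ℚ` (`commutator_sq_mul_mem`). So the commutative algebra `Λ` is generated by finitely many
integral elements.

Grading. The Euler derivation of `A` preserves both `M_i` and the Lie filtration, so it acts on `D`,
with eigenvalue `d` on `degD n i d`; the degree pieces are therefore independent. They span `Λ`,
whose generators may be taken to be brackets of homogeneous elements. Such brackets have positive
degree, so the degree zero part consists of scalars. Scalars inject because the augmentation of `A`
kills `M_2`, hence `M_i`, and so `D ≠ 0`.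

The map `θ`. It is onto because `D` is generated by the symbols of `ℓ` and `ℓ` is spanned by the
`x_j` together with `ℓ'`. For injectivity, `∂/∂x_j` maps `ℓ` to scalars and kills `ℓ'`, so it lowers
the Lie filtration by one and acts on `D`. This action is `Λ`-linear and corresponds under `θ` to
the partial derivative of polynomials over `Λ`. The kernel of `θ` is then stable under partial
derivatives and contains no nonzero constant, since `Λ ⊆ D`; in characteristic zero such a kernel
vanishes. -/

lemma commutator_sq_mul_eq_zero [IsAddTorsionFree A] {z : A}
    (hz : ∀ a b : A, a * (b * z - z * b) - (b * z - z * b) * a = 0)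
    (hz' : ∀ a b : A, (a * b - b * a) * z - z * (a * b - b * a) = 0) (a y w : A) :
    (a * y - y * a) ^ 2 * (w * z - z * w) = 0 := by
  -- Expand `[a, [yw, z]] = 0` by Leibniz: only `[a,y][w,z] + [y,z][a,w]` survives, and `[y,z]` is
  -- central by `hz`.
  have swap : ∀ a y w : A,
      (a * y - y * a) * (w * z - z * w) = -((a * w - w * a) * (y * z - z * y)) := by
    intro a y w
    have e : (a * y - y * a) * (w * z - z * w) =
        (a * (y * w * z - z * (y * w)) - (y * w * z - z * (y * w)) * a)
        - y * (a * (w * z - z * w) - (w * z - z * w) * a)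
        - (a * (y * z - z * y) - (y * z - z * y) * a) * w
        + ((a * w - w * a) * (y * z - z * y) - (y * z - z * y) * (a * w - w * a))
        - (a * w - w * a) * (y * z - z * y) := by
      noncomm_ring
    rw [e, hz, hz, hz, hz]
    simp
  -- For `w = y` the swap gives an element equal to its own negative; here torsion-freeness enters.
  have self : (a * y - y * a) * (y * z - z * y) = 0 := by
    have := swap a y y
    exact self_eq_neg.1 this
  have e : (a * y - y * a) ^ 2 * (w * z - z * w) =
      (a * y - y * a) * ((a * y - y * a) * (w * z - z * w)) := by
    noncomm_ring
  have e' : (a * y - y * a) * ((a * w - w * a) * (y * z - z * y)) =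
      (a * w - w * a) * ((a * y - y * a) * (y * z - z * y)) +
        ((a * y - y * a) * (a * w - w * a) - (a * w - w * a) * (a * y - y * a)) *
          (y * z - z * y) := by
    noncomm_ring
  -- Up to sign, what remains is `[[a,y],[a,w]][y,z]`; a second swap moves `z` next to `[a,w]`, and
  -- `[[a,w],z] = 0` by `hz'`.
  rw [e, swap, mul_neg, e', self, mul_zero, zero_add, swap, hz', mul_zero, neg_zero, neg_zero]

lemma commutator_mem_lowerCentralSeries {k : ℕ} (a : A) {z : A}
    (hz : z ∈ LieModule.lowerCentralSeries R A A k) :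
    a * z - z * a ∈ LieModule.lowerCentralSeries R A A (k + 1) := by
  rw [← Ring.lie_def, LieModule.lowerCentralSeries_succ]
  exact LieSubmodule.lie_mem_lie (LieSubmodule.mem_top a) hz

lemma lowerCentralSeries_succ_induction {k : ℕ} {p : A → Prop} (zero : p 0)
    (add : ∀ x y, p x → p y → p (x + y))
    (comm : ∀ a, ∀ z ∈ LieModule.lowerCentralSeries R A A k, p (a * z - z * a)) :
    ∀ x ∈ LieModule.lowerCentralSeries R A A (k + 1), p x := by
  intro x hx
  rw [LieModule.lowerCentralSeries_succ, ← LieSubmodule.mem_toSubmodule,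
    LieSubmodule.lieIdeal_oper_eq_linear_span'] at hx
  refine Submodule.closure_induction (p := fun x _ => p x) zero (fun x y _ _ => add x y) ?_ hx
  rintro r _ ⟨a, -, z, hz, rfl⟩
  have := comm a (r • z) (SMulMemClass.smul_mem r hz)
  rwa [mul_smul_comm, smul_mul_assoc, ← smul_sub, ← Ring.lie_def] at this

lemma mem_lowerIdeal {k : ℕ} {x : A} (hx : x ∈ LieModule.lowerCentralSeries R A A k) :
    x ∈ lowerIdeal R A (k + 1) :=
  TwoSidedIdeal.subset_span hx

lemma lowerIdeal_induction {k : ℕ} {p : A → Prop}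
    (mem : ∀ x ∈ LieModule.lowerCentralSeries R A A k, p x)
    (add : ∀ x y, p x → p y → p (x + y)) (left : ∀ r x, p x → p (r * x))
    (right : ∀ x r, p x → p (x * r)) : ∀ x ∈ lowerIdeal R A (k + 1), p x := by
  intro x hx
  refine TwoSidedIdeal.span_induction (p := fun x _ => p x) (fun x h => mem x h)
    (mem 0 (LieSubmodule.zero_mem _)) (fun x y _ _ => add x y) (fun x _ h => ?_)
    (fun r x _ => left r x) (fun r x _ => right x r) hx
  simpa using left (-1) x h

lemma lowerIdeal_succ_le (k : ℕ) : lowerIdeal R A (k + 2) ≤ lowerIdeal R A (k + 1) :=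
  lowerIdeal_induction
    (fun _ hx => mem_lowerIdeal (LieModule.antitone_lowerCentralSeries R A A k.le_succ hx))
    (fun _ _ => Ideal.add_mem _) (fun _ _ => Ideal.mul_mem_left _ _)
    (fun _ _ => Ideal.mul_mem_right _ _)

lemma lowerIdeal_le_two {i : ℕ} (hi : 2 ≤ i) : lowerIdeal R A i ≤ lowerIdeal R A 2 := by
  obtain ⟨k, rfl⟩ := Nat.exists_eq_add_of_le' hi
  induction k with
  | zero => exact le_rfl
  | succ k ih => exact (lowerIdeal_succ_le (k + 1)).trans (ih (by omega))

/-- Modulo `M_{k+3}`, an element `z` of `L_{k+1}` satisfies the hypotheses of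
`commutator_sq_mul_eq_zero`, the second one by the Jacobi identity. Mathlib's series starts at index
`0`, so `L_{k+1}` is `lowerCentralSeries R A A k`. -/
lemma commutator_sq_mul_mem [Algebra ℚ A] {k : ℕ} (a y : A) :
    ∀ x ∈ lowerIdeal R A (k + 2), (a * y - y * a) ^ 2 * x ∈ lowerIdeal R A (k + 3) := by
  have : IsAddTorsionFree (A ⧸ lowerIdeal R A (k + 3)) :=
    IsAddTorsionFree.of_module_rat _
  -- The factor `r` makes the claim stable under left multiplication of `x`. On a generator `[w, z]`
  -- it can be moved to the right, as `[w, z]` is central modulo `M_{k+3}`.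
  suffices ∀ x ∈ lowerIdeal R A (k + 2), ∀ r, (a * y - y * a) ^ 2 * (r * x) ∈
      lowerIdeal R A (k + 3) by
    intro x hx
    simpa using this x hx 1
  refine lowerIdeal_induction (lowerCentralSeries_succ_induction ?_ ?_ ?_) ?_ ?_ ?_
  · simp
  · intro x y hx hy r
    rw [mul_add, mul_add]
    exact Ideal.add_mem _ (hx r) (hy r)
  · intro w z hz r
    have hzero : ∀ x ∈ LieModule.lowerCentralSeries R A A (k + 2),
        Ideal.Quotient.mk (lowerIdeal R A (k + 3)) x = 0 :=
      fun x hx => Ideal.Quotient.eq_zero_iff_mem.2 (mem_lowerIdeal hx)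
    have h1 : ∀ a b : A, Ideal.Quotient.mk (lowerIdeal R A (k + 3))
        (a * (b * z - z * b) - (b * z - z * b) * a) = 0 := fun a b =>
      hzero _ (commutator_mem_lowerCentralSeries a (commutator_mem_lowerCentralSeries b hz))
    have h2 : ∀ a b : A, Ideal.Quotient.mk (lowerIdeal R A (k + 3))
        ((a * b - b * a) * z - z * (a * b - b * a)) = 0 := by
      intro a b
      have e : (a * b - b * a) * z - z * (a * b - b * a) =
          (a * (b * z - z * b) - (b * z - z * b) * a) -
            (b * (a * z - z * a) - (a * z - z * a) * b) := by noncomm_ring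
      rw [e, map_sub, h1, h1, sub_zero]
    have key := commutator_sq_mul_eq_zero (z := Ideal.Quotient.mk (lowerIdeal R A (k + 3)) z)
      (fun a b => by
        obtain ⟨a, rfl⟩ := Ideal.Quotient.mk_surjective a
        obtain ⟨b, rfl⟩ := Ideal.Quotient.mk_surjective b
        simpa using h1 a b)
      (fun a b => by
        obtain ⟨a, rfl⟩ := Ideal.Quotient.mk_surjective a
        obtain ⟨b, rfl⟩ := Ideal.Quotient.mk_surjective b
        simpa using h2 a b) (Ideal.Quotient.mk _ a) (Ideal.Quotient.mk _ y)
        (Ideal.Quotient.mk _ w)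
    have key' : (a * y - y * a) ^ 2 * (w * z - z * w) ∈ lowerIdeal R A (k + 3) :=
      Ideal.Quotient.eq_zero_iff_mem.1 (by simpa using key)
    have e : (a * y - y * a) ^ 2 * (r * (w * z - z * w)) =
        (a * y - y * a) ^ 2 * (w * z - z * w) * r +
          (a * y - y * a) ^ 2 * (r * (w * z - z * w) - (w * z - z * w) * r) := by noncomm_ring
    rw [e]
    exact Ideal.add_mem _ (Ideal.mul_mem_right _ _ key')
      (Ideal.mul_mem_left _ _ (Ideal.Quotient.eq_zero_iff_mem.1 (h1 r w)))
  · intro x y hx hy r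
    rw [mul_add, mul_add]
    exact Ideal.add_mem _ (hx r) (hy r)
  · intro s x hx r
    rw [← mul_assoc r]
    exact hx (r * s)
  · intro x s hx r
    rw [← mul_assoc r, ← mul_assoc]
    exact Ideal.mul_mem_right _ _ (hx r)

/-- Commutators are nilpotent modulo each of the ideals `M_i(A)`. -/
lemma commutator_pow_mem_lowerIdeal [Algebra ℚ A] (a y : A) (k : ℕ) :
    (a * y - y * a) ^ (2 * k + 1) ∈ lowerIdeal R A (k + 2) := by
  induction k with
  | zero =>
    rw [mul_zero, zero_add, pow_one]
    exact mem_lowerIdeal (commutator_mem_lowerCentralSeries (k := 0) a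
      (by simp))
  | succ k ih =>
    have := commutator_sq_mul_mem a y _ ih
    rwa [← pow_add, show 2 + (2 * k + 1) = 2 * (k + 1) + 1 by ring] at this

/-- A derivation of `A` preserves the ideals `M_i(A)`. -/
lemma leibniz_map_lowerIdeal (δ : A →ₗ[R] A) (hδ : ∀ a b, δ (a * b) = δ a * b + a * δ b) (k : ℕ) :
    ∀ x ∈ lowerIdeal R A (k + 1), δ x ∈ lowerIdeal R A (k + 1) := by
  have hL : ∀ x ∈ LieModule.lowerCentralSeries R A A k,
      δ x ∈ LieModule.lowerCentralSeries R A A k := by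
    induction k with
    | zero => simp
    | succ k ih =>
      refine lowerCentralSeries_succ_induction ?_ ?_ ?_
      · rw [map_zero]
        exact LieSubmodule.zero_mem _
      · intro x y hx hy
        rw [map_add]
        exact add_mem hx hy
      · intro a z hz
        have e : δ (a * z - z * a) = (δ a * z - z * δ a) + (a * δ z - δ z * a) := by
          rw [map_sub, hδ, hδ]
          abel
        rw [e]
        exact add_mem (commutator_mem_lowerCentralSeries _ hz)
          (commutator_mem_lowerCentralSeries _ (ih z hz))
  intro x hx
  -- Membership of `x` itself is carried along, because `δ (r * x)` contains the term `δ r * x`.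
  refine (lowerIdeal_induction (p := fun x => x ∈ lowerIdeal R A (k + 1) ∧
    δ x ∈ lowerIdeal R A (k + 1)) (fun x hx => ⟨mem_lowerIdeal hx, mem_lowerIdeal (hL x hx)⟩)
    ?_ ?_ ?_ x hx).2
  · rintro x y ⟨hx, hx'⟩ ⟨hy, hy'⟩
    rw [map_add]
    exact ⟨Ideal.add_mem _ hx hy, Ideal.add_mem _ hx' hy'⟩
  · rintro r x ⟨hx, hx'⟩
    rw [hδ]
    exact ⟨Ideal.mul_mem_left _ _ hx,
      Ideal.add_mem _ (Ideal.mul_mem_left _ _ hx) (Ideal.mul_mem_left _ _ hx')⟩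
  · rintro x r ⟨hx, hx'⟩
    rw [hδ]
    exact ⟨Ideal.mul_mem_right _ _ hx,
      Ideal.add_mem _ (Ideal.mul_mem_right _ _ hx') (Ideal.mul_mem_right _ _ hx)⟩

/-- A homomorphism to a commutative ring kills `M_2(A)`. -/
lemma map_lowerIdeal_two {B : Type*} [CommRing B] (φ : A →+* B) :
    ∀ x ∈ lowerIdeal R A 2, φ x = 0 := by
  refine lowerIdeal_induction (lowerCentralSeries_succ_induction ?_ ?_ ?_) ?_ ?_ ?_
  · simp
  · intro x y hx hy
    rw [map_add, hx, hy, add_zero]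
  · intro a z _
    rw [map_sub, map_mul, map_mul, mul_comm, sub_self]
  · intro x y hx hy
    rw [map_add, hx, hy, add_zero]
  · intro r x hx
    rw [map_mul, hx, mul_zero]
  · intro x r hx
    rw [map_mul, hx, zero_mul]

end LowerIdeal

/-! ### Lower central quotients of finitely generated Lie algebras -/

section Lie

variable {R L : Type*} [CommRing R] [LieRing L] [LieAlgebra R L]

lemma lie_mem_lowerCentralSeries_succ (x : L) {k : ℕ} {y : L}
    (hy : y ∈ LieModule.lowerCentralSeries R L L k) :
    ⁅x, y⁆ ∈ LieModule.lowerCentralSeries R L L (k + 1) := by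
  rw [LieModule.lowerCentralSeries_succ]
  exact LieSubmodule.lie_mem_lie (LieSubmodule.mem_top x) hy

/-- By Jacobi, bracketing with `[a, b]` is a difference of two double brackets, each of which climbs
two steps. -/
lemma lie_mem_lowerCentralSeries_add_two {x : L} (hx : x ∈ LieModule.lowerCentralSeries R L L 1)
    {k : ℕ} {y : L} (hy : y ∈ LieModule.lowerCentralSeries R L L k) :
    ⁅x, y⁆ ∈ LieModule.lowerCentralSeries R L L (k + 2) := by
  rw [LieModule.lowerCentralSeries_succ, ← LieSubmodule.mem_toSubmodule,
    LieSubmodule.lieIdeal_oper_eq_linear_span'] at hx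
  induction hx using Submodule.span_induction with
  | zero => simp
  | add a b _ _ ha hb => rw [add_lie]; exact add_mem ha hb
  | smul r a _ ha => rw [smul_lie]; exact SMulMemClass.smul_mem r ha
  | mem a ha =>
    obtain ⟨a, -, b, -, rfl⟩ := ha
    rw [lie_lie]
    exact sub_mem (lie_mem_lowerCentralSeries_succ _ (lie_mem_lowerCentralSeries_succ _ hy))
      (lie_mem_lowerCentralSeries_succ _ (lie_mem_lowerCentralSeries_succ _ hy))

/-- If `L` is spanned by a finitely generated submodule modulo `[L, L]`, then so are all the
quotients by the terms of its lower central series. -/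
lemma exists_fg_sup_lowerCentralSeries {V : Submodule R L} (hV : V.FG)
    (h : V ⊔ (LieModule.lowerCentralSeries R L L 1).toSubmodule = ⊤) (k : ℕ) :
    ∃ W : Submodule R L, W.FG ∧ W ⊔ (LieModule.lowerCentralSeries R L L k).toSubmodule = ⊤ := by
  have step : ∀ k, ∃ U : Submodule R L, U.FG ∧
      (LieModule.lowerCentralSeries R L L k).toSubmodule ≤
        U ⊔ (LieModule.lowerCentralSeries R L L (k + 1)).toSubmodule := by
    intro k
    induction k with
    | zero => exact ⟨V, hV, le_top.trans h.ge⟩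
    | succ k ih =>
      obtain ⟨U, hU, hUk⟩ := ih
      -- The new complement is `[V, U]`: changing `x` by an element of `[L, L]`, or `y` by one of
      -- the next term of the series, alters `[x, y]` only two steps further down.
      refine ⟨Submodule.map₂ (LieModule.toEnd R L L : L →ₗ[R] Module.End R L) V U,
        hV.map₂ _ hU, ?_⟩
      rw [LieModule.lowerCentralSeries_succ R L L k, LieSubmodule.lieIdeal_oper_eq_linear_span',
        Submodule.span_le]
      rintro _ ⟨x, -, y, hy, rfl⟩
      have hx : x ∈ V ⊔ (LieModule.lowerCentralSeries R L L 1).toSubmodule :=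
        h.ge Submodule.mem_top
      obtain ⟨v, hv, v', hv', rfl⟩ := Submodule.mem_sup.1 hx
      obtain ⟨u, hu, u', hu', rfl⟩ := Submodule.mem_sup.1 (hUk hy)
      have e : ⁅v + v', u + u'⁆ = ⁅v, u⁆ + (⁅v, u'⁆ + ⁅v', u + u'⁆) := by
        rw [add_lie, lie_add v, add_assoc]
      rw [SetLike.mem_coe, e]
      refine Submodule.add_mem _ (Submodule.mem_sup_left (Submodule.apply_mem_map₂ _ hv hu))
        (Submodule.mem_sup_right (Submodule.add_mem _ ?_ ?_))
      · exact lie_mem_lowerCentralSeries_succ v hu'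
      · exact lie_mem_lowerCentralSeries_add_two hv' hy
  induction k with
  | zero => exact ⟨⊥, Submodule.fg_bot, by simp⟩
  | succ k ih =>
    obtain ⟨W, hW, hWk⟩ := ih
    obtain ⟨U, hU, hUk⟩ := step k
    refine ⟨W ⊔ U, hW.sup hU, ?_⟩
    rw [eq_top_iff, ← hWk, sup_assoc]
    exact sup_le_sup_left hUk W

/-- The universal property gives a right inverse of the inclusion of `S`. This serves as the
induction principle for `ℓ_n`. -/
lemma freeLieAlgebra_subalgebra_eq_top {X : Type*} (S : LieSubalgebra R (FreeLieAlgebra R X))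
    (hS : ∀ x, FreeLieAlgebra.of R x ∈ S) : S = ⊤ := by
  have h : S.incl.comp (FreeLieAlgebra.lift R fun x => (⟨FreeLieAlgebra.of R x, hS x⟩ : S)) =
      LieHom.id :=
    FreeLieAlgebra.hom_ext fun x => by simp
  rw [eq_top_iff]
  intro y _
  have := LieHom.congr_fun h y
  rw [LieHom.id_apply] at this
  rw [← this]
  exact Subtype.prop _

end Lie

/-! ### Derivations of free algebras -/

section Derivation

variable {R X : Type*} [CommRing R]

/-- The algebra homomorphism `a ↦ (a, δ a)`, where `δ` is the derivation with `δ x = d x` for the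
generators `x`. -/
def freeDerivAux (d : X → FreeAlgebra R X) :
    FreeAlgebra R X →ₐ[R] TrivSqZeroExt (FreeAlgebra R X) (FreeAlgebra R X) :=
  FreeAlgebra.lift R fun x => TrivSqZeroExt.inl (FreeAlgebra.ι R x) + TrivSqZeroExt.inr (d x)

lemma fst_freeDerivAux (d : X → FreeAlgebra R X) (a : FreeAlgebra R X) :
    (freeDerivAux d a).fst = a := by
  have : (TrivSqZeroExt.fstHom R (FreeAlgebra R X) (FreeAlgebra R X)).comp (freeDerivAux d) =
      AlgHom.id R _ := by
    ext x
    simp [freeDerivAux]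
  exact DFunLike.congr_fun this a

/-- The derivation of a free algebra with given values at the generators. -/
def freeDeriv (d : X → FreeAlgebra R X) : FreeAlgebra R X →ₗ[R] FreeAlgebra R X :=
  (TrivSqZeroExt.sndHom (FreeAlgebra R X) (FreeAlgebra R X)).restrictScalars R ∘ₗ
    (freeDerivAux d).toLinearMap

lemma freeDeriv_apply (d : X → FreeAlgebra R X) (a : FreeAlgebra R X) :
    freeDeriv d a = (freeDerivAux d a).snd := rfl

@[simp]
lemma freeDeriv_ι (d : X → FreeAlgebra R X) (x : X) : freeDeriv d (FreeAlgebra.ι R x) = d x := by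
  simp [freeDeriv_apply, freeDerivAux]

lemma freeDeriv_mul (d : X → FreeAlgebra R X) (a b : FreeAlgebra R X) :
    freeDeriv d (a * b) = freeDeriv d a * b + a * freeDeriv d b := by
  simp only [freeDeriv_apply, map_mul, TrivSqZeroExt.snd_mul, fst_freeDerivAux, smul_eq_mul,
    MulOpposite.smul_eq_mul_unop, MulOpposite.unop_op]
  rw [add_comm]

lemma freeDeriv_one (d : X → FreeAlgebra R X) : freeDeriv d 1 = 0 := by
  simp [freeDeriv_apply]

lemma freeDeriv_algebraMap (d : X → FreeAlgebra R X) (r : R) :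
    freeDeriv d (algebraMap R _ r) = 0 := by
  rw [Algebra.algebraMap_eq_smul_one, map_smul, freeDeriv_one, smul_zero]

end Derivation


/-! ### Symbols and maps of associated graded algebras -/

namespace ACFiltration

variable {R A : Type*} [CommRing R] [Ring A] [Algebra R A] (𝓕 : ACFiltration R A)

lemma symbol_congr {m m' : ℕ} (h : m = m') {a : 𝓕.F m} {b : 𝓕.F m'} (hab : (a : A) = b) :
    𝓕.symbol m a = 𝓕.symbol m' b := by
  subst h
  rw [Subtype.ext hab]

lemma symbol_eq_zero {m : ℕ} {a : 𝓕.F m} (ha : (a : A) ∈ below 𝓕.F m) : 𝓕.symbol m a = 0 := by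
  have : 𝓕.cls m a = 0 := (Submodule.Quotient.mk_eq_zero _).2 ha
  show DirectSum.of 𝓕.grPiece m (𝓕.cls m a) = 0
  rw [this, map_zero]

lemma mem_below_of_symbol_eq_zero {m : ℕ} {a : 𝓕.F m} (ha : 𝓕.symbol m a = 0) :
    (a : A) ∈ below 𝓕.F m := by
  have h : DirectSum.of 𝓕.grPiece m (𝓕.cls m a) = DirectSum.of 𝓕.grPiece m 0 :=
    (map_zero (DirectSum.of 𝓕.grPiece m)).symm ▸ ha
  exact (Submodule.Quotient.mk_eq_zero ((below 𝓕.F m).comap (𝓕.F m).subtype)).1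
    (DirectSum.of_injective m h)

lemma symbol_mul {i j : ℕ} (a : 𝓕.F i) (b : 𝓕.F j) :
    𝓕.symbol i a * 𝓕.symbol j b = 𝓕.symbol (i + j) ⟨a * b, 𝓕.mul_mem a.2 b.2⟩ :=
  DirectSum.of_mul_of (A := 𝓕.grPiece) (𝓕.cls i a) (𝓕.cls j b)

lemma symbol_one : 𝓕.symbol 0 ⟨1, 𝓕.one_mem⟩ = 1 := rfl

lemma gr_induction {p : 𝓕.Gr → Prop} (zero : p 0) (add : ∀ x y, p x → p y → p (x + y))
    (symbol : ∀ m a, p (𝓕.symbol m a)) (x : 𝓕.Gr) : p x := by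
  refine DirectSum.induction_on (motive := p) x zero (fun m y => ?_) add
  obtain ⟨a, rfl⟩ := 𝓕.cls_surj m y
  exact symbol m a

/-- The map of associated graded spaces defined by a linear map which sends `F m` to `F (σ m)`. -/
def grMap (T : A →ₗ[R] A) (σ : ℕ → ℕ) (h : ∀ m, ∀ a ∈ 𝓕.F m, T a ∈ 𝓕.F (σ m))
    (h' : ∀ m, ∀ a ∈ below 𝓕.F m, T a ∈ below 𝓕.F (σ m)) : 𝓕.Gr →ₗ[R] 𝓕.Gr :=
  DirectSum.toModule R ℕ 𝓕.Gr fun m =>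
    Submodule.liftQ _ ((𝓕.symbol (σ m)).comp (T.restrict (h m)))
      fun a ha => 𝓕.symbol_eq_zero (h' m a ha)

lemma grMap_symbol (T : A →ₗ[R] A) (σ : ℕ → ℕ) (h : ∀ m, ∀ a ∈ 𝓕.F m, T a ∈ 𝓕.F (σ m))
    (h' : ∀ m, ∀ a ∈ below 𝓕.F m, T a ∈ below 𝓕.F (σ m)) (m : ℕ) (a : 𝓕.F m) :
    𝓕.grMap T σ h h' (𝓕.symbol m a) = 𝓕.symbol (σ m) ⟨T a, h m a a.2⟩ :=
  (DirectSum.toModule_lof (M := 𝓕.grPiece) R m (𝓕.cls m a)).trans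
    (Submodule.liftQ_apply _ _ _)

end ACFiltration

/-! ### Symbols in `D_{n,i}` -/

section Symbols

variable {n i : ℕ}

lemma toQ_surjective : Function.Surjective (toQ n i) := Ideal.Quotient.mk_surjective

lemma toQ_eq_zero {a : An n} : toQ n i a = 0 ↔ a ∈ lowerIdeal ℂ (An n) i :=
  Ideal.Quotient.eq_zero_iff_mem

lemma symbolQ_congr {m m' : ℕ} (h : m = m') {a b : An n} (hab : a = b) (ha : a ∈ (filtA n).F m)
    (hb : b ∈ (filtA n).F m') : symbolQ n i m a ha = symbolQ n i m' b hb := by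
  subst h hab
  rfl

lemma mem_below_filtQ {m : ℕ} {q : Q n i} :
    q ∈ below (filtQ n i).F m ↔ ∃ a ∈ below (filtA n).F m, toQ n i a = q := by
  cases m with
  | zero =>
    simp only [below, Submodule.mem_bot, exists_eq_left, map_zero]
    exact eq_comm
  | succ m => exact Iff.rfl

lemma symbolQ_eq_zero {m : ℕ} {a : An n} (ha : a ∈ (filtA n).F m)
    (h : a ∈ below (filtA n).F m) : symbolQ n i m a ha = 0 :=
  (filtQ n i).symbol_eq_zero (mem_below_filtQ.2 ⟨a, h, rfl⟩)

lemma symbolQ_eq_zero_of_mem_lowerIdeal {m : ℕ} {a : An n} (ha : a ∈ (filtA n).F m)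
    (h : a ∈ lowerIdeal ℂ (An n) i) : symbolQ n i m a ha = 0 :=
  (filtQ n i).symbol_eq_zero (by
    show toQ n i a ∈ _
    rw [toQ_eq_zero.2 h]
    exact Submodule.zero_mem _)

lemma symbolQ_add {m : ℕ} {a b : An n} (ha : a ∈ (filtA n).F m) (hb : b ∈ (filtA n).F m) :
    symbolQ n i m (a + b) (Submodule.add_mem _ ha hb) =
      symbolQ n i m a ha + symbolQ n i m b hb := by
  unfold symbolQ
  rw [← map_add]
  exact (filtQ n i).symbol_congr rfl (map_add _ _ _)

lemma symbolQ_smul {m : ℕ} (r : ℂ) {a : An n} (ha : a ∈ (filtA n).F m) :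
    symbolQ n i m (r • a) (Submodule.smul_mem _ r ha) = r • symbolQ n i m a ha := by
  unfold symbolQ
  rw [← map_smul]
  exact (filtQ n i).symbol_congr rfl (map_smul _ _ _)

lemma symbolQ_mul {m k : ℕ} {a b : An n} (ha : a ∈ (filtA n).F m) (hb : b ∈ (filtA n).F k) :
    symbolQ n i m a ha * symbolQ n i k b hb =
      symbolQ n i (m + k) (a * b) ((filtA n).mul_mem ha hb) :=
  ((filtQ n i).symbol_mul _ _).trans ((filtQ n i).symbol_congr rfl (map_mul _ _ _).symm)

lemma symbolQ_one : symbolQ n i 0 1 (filtA n).one_mem = 1 :=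
  (filtQ n i).symbol_congr rfl (map_one _)

lemma symbolQ_algebraMap (r : ℂ) :
    symbolQ n i 0 (algebraMap ℂ _ r) ((filtA n).algebraMap_mem r) = algebraMap ℂ (D n i) r := by
  rw [Algebra.algebraMap_eq_smul_one (A := D n i), ← symbolQ_one, ← symbolQ_smul]
  exact symbolQ_congr rfl (Algebra.algebraMap_eq_smul_one r) _ _

lemma gr_induction {p : D n i → Prop} (zero : p 0) (add : ∀ x y, p x → p y → p (x + y))
    (symbol : ∀ m a ha, p (symbolQ n i m a ha)) (x : D n i) : p x := by
  refine (filtQ n i).gr_induction zero add (fun m q => ?_) x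
  obtain ⟨_, a, ha, rfl⟩ := q
  exact symbol m a ha

lemma symbolQ_pow {m : ℕ} {a : An n} (ha : a ∈ (filtA n).F m) (k : ℕ) :
    ∃ hk, symbolQ n i m a ha ^ k = symbolQ n i (m * k) (a ^ k) hk := by
  induction k with
  | zero =>
    refine ⟨by simpa using (filtA n).one_mem, ?_⟩
    rw [pow_zero, ← symbolQ_one]
    exact symbolQ_congr (by simp) (by simp) _ _
  | succ k ih =>
    obtain ⟨hk, h⟩ := ih
    have h' : a ^ (k + 1) ∈ (filtA n).F (m * (k + 1)) := by
      rw [pow_succ, mul_add_one]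
      exact (filtA n).mul_mem hk ha
    refine ⟨h', ?_⟩
    rw [pow_succ, h, symbolQ_mul]
    exact symbolQ_congr (by ring) (pow_succ _ _).symm _ _

/-- A derivation of `A_n` compatible with the Lie filtration acts on `D_{n,i}`. -/
lemma exists_grMap (hi : 1 ≤ i) (δ : An n →ₗ[ℂ] An n)
    (hδ : ∀ a b, δ (a * b) = δ a * b + a * δ b) (σ : ℕ → ℕ)
    (h : ∀ m, ∀ a ∈ (filtA n).F m, δ a ∈ (filtA n).F (σ m))
    (h' : ∀ m, ∀ a ∈ below (filtA n).F m, δ a ∈ below (filtA n).F (σ m)) :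
    ∃ T : D n i →ₗ[ℂ] D n i, ∀ m a ha, T (symbolQ n i m a ha) =
      symbolQ n i (σ m) (δ a) (h m a ha) := by
  -- As `δ` preserves `M_i`, the composite `toQ ∘ δ ∘ g` with a linear section `g` is the map
  -- induced on `Q`, whichever section is taken.
  obtain ⟨g, hg⟩ := (toQ n i).toLinearMap.exists_rightInverse_of_surjective
    (LinearMap.range_eq_top.2 toQ_surjective)
  have hT : ∀ a, toQ n i (δ (g (toQ n i a))) = toQ n i (δ a) := by
    intro a
    rw [← sub_eq_zero, ← map_sub, ← map_sub, toQ_eq_zero]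
    obtain ⟨k, rfl⟩ := Nat.exists_eq_add_of_le' hi
    refine leibniz_map_lowerIdeal δ hδ k _ ?_
    rw [← toQ_eq_zero, map_sub, sub_eq_zero]
    exact LinearMap.congr_fun hg (toQ n (k + 1) a)
  refine ⟨(filtQ n i).grMap ((toQ n i).toLinearMap ∘ₗ δ ∘ₗ g) σ ?_ ?_, ?_⟩
  · rintro m _ ⟨a, ha, rfl⟩
    exact ⟨δ a, h m a ha, (hT a).symm⟩
  · intro m q hq
    obtain ⟨a, ha, rfl⟩ := mem_below_filtQ.1 hq
    exact mem_below_filtQ.2 ⟨δ a, h' m a ha, (hT a).symm⟩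
  · intro m a ha
    exact ((filtQ n i).grMap_symbol _ _ _ _ _ _).trans ((filtQ n i).symbol_congr rfl (hT a))

lemma filtA_succ_induction {m : ℕ} {p : An n → Prop} (add : ∀ a b, p a → p b → p (a + b))
    (mul_scalar : ∀ a ∈ (filtA n).F m, ∀ r : ℂ, p (r • a))
    (mul_lie : ∀ a ∈ (filtA n).F m, ∀ z, p (a * ellToA n z)) :
    ∀ a ∈ (filtA n).F (m + 1), p a := by
  intro a ha
  have ha' : a ∈ (1 ⊔ LinearMap.range (ellToA n : elln n →ₗ[ℂ] An n)) ^ m *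
      (1 ⊔ LinearMap.range (ellToA n : elln n →ₗ[ℂ] An n)) := by
    rw [← pow_succ]
    exact ha
  refine Submodule.mul_induction_on ha' ?_ add
  intro x hx y hy
  obtain ⟨r, hr, _, ⟨z, rfl⟩, rfl⟩ := Submodule.mem_sup.1 hy
  obtain ⟨r, rfl⟩ := Submodule.mem_one.1 hr
  rw [mul_add]
  refine add _ _ ?_ (mul_lie x hx z)
  rw [← Algebra.commutes, ← Algebra.smul_def]
  exact mul_scalar x hx r

lemma mem_filtA_zero {a : An n} : a ∈ (filtA n).F 0 ↔ ∃ r, algebraMap ℂ (An n) r = a := by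
  show a ∈ (1 ⊔ LinearMap.range (ellToA n : elln n →ₗ[ℂ] An n)) ^ 0 ↔ _
  rw [pow_zero, Submodule.mem_one]

end Symbols

/-! ### The Euler derivation and the grading by degree -/

section Degree

variable {n i : ℕ}

lemma mul_mem_degA {d e : ℕ} {a b : An n} (ha : a ∈ degA n d) (hb : b ∈ degA n e) :
    a * b ∈ degA n (d + e) := by
  unfold degA
  rw [pow_add]
  exact Submodule.mul_mem_mul ha hb

lemma lie_mem_degA {d e : ℕ} {y z : elln n} (hy : ellToA n y ∈ degA n d)
    (hz : ellToA n z ∈ degA n e) : ellToA n ⁅y, z⁆ ∈ degA n (d + e) := by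
  rw [LieHom.map_lie, Ring.lie_def]
  have h := mul_mem_degA hz hy
  rw [add_comm e] at h
  exact Submodule.sub_mem _ (mul_mem_degA hy hz) h

/-- The span on the left contains the generators and is closed under brackets. Positivity of the
degree `d + 1` is what later confines the degree zero part of `Λ` to scalars. -/
lemma elln_eq_span (n : ℕ) :
    Submodule.span ℂ {z : elln n | ∃ d, ellToA n z ∈ degA n (d + 1)} = ⊤ := by
  let S : LieSubalgebra ℂ (elln n) :=
    { Submodule.span ℂ {z : elln n | ∃ d, ellToA n z ∈ degA n (d + 1)} with
      lie_mem' := by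
        intro x y hx hy
        change ⁅x, y⁆ ∈ Submodule.span ℂ {z : elln n | ∃ d, ellToA n z ∈ degA n (d + 1)}
        change x ∈ Submodule.span ℂ _ at hx
        change y ∈ Submodule.span ℂ _ at hy
        induction hx, hy using Submodule.span_induction₂ with
        | mem_mem x y hx hy =>
          obtain ⟨d, hd⟩ := hx
          obtain ⟨e, he⟩ := hy
          have h := lie_mem_degA hd he
          exact Submodule.subset_span ⟨d + 1 + e, h⟩
        | zero_left y _ => simp
        | zero_right x _ => simp
        | add_left x y z _ _ _ h h' => rw [add_lie]; exact Submodule.add_mem _ h h'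
        | add_right x y z _ _ _ h h' => rw [lie_add]; exact Submodule.add_mem _ h h'
        | smul_left r x y _ _ h => rw [smul_lie]; exact Submodule.smul_mem _ r h
        | smul_right r x y _ _ h => rw [lie_smul]; exact Submodule.smul_mem _ r h }
  have hS : S = ⊤ := by
    refine freeLieAlgebra_subalgebra_eq_top S fun x => Submodule.subset_span ⟨0, ?_⟩
    simp only [ellToA, FreeLieAlgebra.lift_of_apply, degA, zero_add, pow_one]
    exact Submodule.subset_span ⟨x, rfl⟩
  rw [eq_top_iff]
  intro z _
  have : z ∈ S := hS ▸ LieSubalgebra.mem_top z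
  exact this

/-- The Euler derivation of `A_n`. -/
def euler (n : ℕ) : An n →ₗ[ℂ] An n := freeDeriv (FreeAlgebra.ι ℂ)

lemma euler_of_mem_degA {d : ℕ} : ∀ a ∈ degA n d, euler n a = (d : ℂ) • a := by
  induction d with
  | zero =>
    intro a ha
    unfold degA at ha
    rw [pow_zero] at ha
    obtain ⟨r, rfl⟩ := Submodule.mem_one.1 ha
    simp [euler, freeDeriv_algebraMap]
  | succ d ih =>
    intro a ha
    unfold degA at ha
    rw [pow_succ] at ha
    refine Submodule.mul_induction_on ha ?_ ?_
    · intro x hx y hy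
      have hy' : euler n y = y := by
        induction hy using Submodule.span_induction with
        | mem y hy =>
          obtain ⟨j, rfl⟩ := hy
          exact freeDeriv_ι _ _
        | zero => simp
        | add a b _ _ ha hb => rw [map_add, ha, hb]
        | smul r a _ ha => rw [map_smul, ha]
      have := freeDeriv_mul (FreeAlgebra.ι ℂ) x y
      change euler n (x * y) = euler n x * y + x * euler n y at this
      rw [this, ih x hx, hy', smul_mul_assoc, Nat.cast_succ, add_smul, one_smul]
    · intro x y hx hy
      rw [map_add, hx, hy, smul_add]

lemma euler_ellToA (z : elln n) : euler n (ellToA n z) ∈ (filtA n).F 1 := by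
  have hz : z ∈ Submodule.span ℂ {z : elln n | ∃ d, ellToA n z ∈ degA n (d + 1)} := by
    rw [elln_eq_span]
    trivial
  induction hz using Submodule.span_induction with
  | mem z hz =>
    obtain ⟨d, hd⟩ := hz
    rw [euler_of_mem_degA _ hd]
    exact Submodule.smul_mem _ _ (ellToA_mem n z)
  | zero => simp
  | add a b _ _ ha hb => rw [map_add, map_add]; exact Submodule.add_mem _ ha hb
  | smul r a _ ha => rw [map_smul, map_smul]; exact Submodule.smul_mem _ r ha

lemma euler_mem_filtA {m : ℕ} : ∀ a ∈ (filtA n).F m, euler n a ∈ (filtA n).F m := by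
  induction m with
  | zero =>
    intro a ha
    obtain ⟨r, rfl⟩ := mem_filtA_zero.1 ha
    rw [euler, freeDeriv_algebraMap]
    exact Submodule.zero_mem _
  | succ m ih =>
    refine filtA_succ_induction ?_ ?_ ?_
    · intro a b ha hb
      rw [map_add]
      exact Submodule.add_mem _ ha hb
    · intro a ha r
      rw [map_smul]
      exact Submodule.smul_mem _ r ((filtA n).mono m.le_succ (ih a ha))
    · intro a ha z
      rw [euler, freeDeriv_mul]
      exact Submodule.add_mem _ ((filtA n).mul_mem (ih a ha) (ellToA_mem n z))
        ((filtA n).mul_mem ha (euler_ellToA z))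

/-- The degree pieces sit inside eigenspaces of the operator induced by the Euler derivation, with
distinct eigenvalues `d` in `ℂ`. -/
lemma iSupIndep_degD (hi : 1 ≤ i) : iSupIndep (degD n i) := by
  obtain ⟨T, hT⟩ := exists_grMap hi (euler n) (freeDeriv_mul _) id
    (fun m a ha => euler_mem_filtA a ha) (fun m => by
      cases m with
      | zero =>
        intro a ha
        rw [(Submodule.mem_bot ℂ).1 ha, map_zero]
        exact Submodule.zero_mem _
      | succ m => exact fun a ha => euler_mem_filtA a ha)
  have h := (Module.End.eigenspaces_iSupIndep T).comp (Nat.cast_injective (R := ℂ))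
  refine h.mono fun d => Submodule.span_le.2 ?_
  rintro _ ⟨m, a, ha, had, rfl⟩
  refine Module.End.mem_eigenspace_iff.2 ?_
  rw [hT, ← symbolQ_smul]
  exact symbolQ_congr rfl (euler_of_mem_degA a had) _ _

lemma mul_mem_degD {d e : ℕ} {x y : D n i} (hx : x ∈ degD n i d) (hy : y ∈ degD n i e) :
    x * y ∈ degD n i (d + e) := by
  have : degD n i d * degD n i e ≤ degD n i (d + e) := by
    unfold degD
    rw [Submodule.span_mul_span, Submodule.span_le]
    rintro _ ⟨_, ⟨m, a, ha, had, rfl⟩, _, ⟨k, b, hb, hbe, rfl⟩, rfl⟩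
    exact Submodule.subset_span ⟨m + k, a * b, (filtA n).mul_mem ha hb, mul_mem_degA had hbe,
      (symbolQ_mul ha hb).symm⟩
  exact this (Submodule.mul_mem_mul hx hy)

lemma algebraMap_mem_degD (r : ℂ) : algebraMap ℂ (D n i) r ∈ degD n i 0 := by
  refine Submodule.subset_span ⟨0, algebraMap ℂ _ r, (filtA n).algebraMap_mem r, ?_,
    symbolQ_algebraMap r⟩
  unfold degA
  rw [pow_zero]
  exact Submodule.mem_one.2 ⟨r, rfl⟩

lemma ellToD_mem_degD {d : ℕ} {z : elln n} (hz : ellToA n z ∈ degA n d) :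
    ellToD n i z ∈ degD n i d :=
  Submodule.subset_span ⟨1, _, ellToA_mem n z, hz, rfl⟩

end Degree


variable {n i : ℕ}

/-! ### Partial derivatives -/

section Partial

/-- The derivation `∂/∂x_j` of `A_n`. -/
def partialA (n : ℕ) (j : Fin n) : An n →ₗ[ℂ] An n := freeDeriv (Pi.single j 1)

lemma partialA_mul (j : Fin n) (a b : An n) :
    partialA n j (a * b) = partialA n j a * b + a * partialA n j b :=
  freeDeriv_mul _ a b

lemma partialA_algebraMap (j : Fin n) (r : ℂ) : partialA n j (algebraMap ℂ _ r) = 0 :=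
  freeDeriv_algebraMap _ r

lemma partialA_of (j k : Fin n) : partialA n j (ellToA n (FreeLieAlgebra.of ℂ k)) =
    algebraMap ℂ _ (Pi.single (M := fun _ => ℂ) j 1 k) := by
  rw [ellToA, FreeLieAlgebra.lift_of_apply, partialA, freeDeriv_ι]
  by_cases h : k = j
  · subst h; simp
  · simp [h]

lemma partialA_lie {j : Fin n} {y z : elln n} {r s : ℂ}
    (hy : partialA n j (ellToA n y) = algebraMap ℂ _ r)
    (hz : partialA n j (ellToA n z) = algebraMap ℂ _ s) :
    partialA n j (ellToA n ⁅y, z⁆) = 0 := by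
  rw [LieHom.map_lie, Ring.lie_def, map_sub, partialA_mul, partialA_mul, hy, hz,
    Algebra.commutes, Algebra.commutes]
  abel

/-- The derivative of a commutator vanishes once both entries have scalar, hence central,
derivatives; so the condition defines a Lie subalgebra, and it contains the generators. -/
lemma exists_partialA_ellToA (j : Fin n) (z : elln n) :
    ∃ r, algebraMap ℂ _ r = partialA n j (ellToA n z) := by
  let S : LieSubalgebra ℂ (elln n) :=
    { Submodule.comap (partialA n j ∘ₗ (ellToA n : elln n →ₗ[ℂ] An n)) 1 with
      lie_mem' := by
        intro y z hy hz
        obtain ⟨r, hr⟩ := Submodule.mem_one.1 (Submodule.mem_comap.1 hy)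
        obtain ⟨s, hs⟩ := Submodule.mem_one.1 (Submodule.mem_comap.1 hz)
        refine Submodule.mem_comap.2 (Submodule.mem_one.2 ⟨0, ?_⟩)
        rw [map_zero]
        exact (partialA_lie hr.symm hs.symm).symm }
  have hS : S = ⊤ := freeLieAlgebra_subalgebra_eq_top S fun k =>
    Submodule.mem_comap.2 (Submodule.mem_one.2 ⟨_, (partialA_of j k).symm⟩)
  have hz : z ∈ S := hS ▸ LieSubalgebra.mem_top z
  exact Submodule.mem_one.1 (Submodule.mem_comap.1 hz)

lemma ellPrime_eq_span (n : ℕ) : (ellPrime n).toSubmodule =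
    Submodule.span ℂ {z | ∃ u v : elln n, ⁅u, v⁆ = z} := by
  rw [ellPrime, LieSubmodule.lieIdeal_oper_eq_linear_span']
  simp

lemma partialA_ellPrime (j : Fin n) {z : elln n} (hz : z ∈ (ellPrime n).toSubmodule) :
    partialA n j (ellToA n z) = 0 := by
  rw [ellPrime_eq_span] at hz
  induction hz using Submodule.span_induction with
  | mem z hz =>
    obtain ⟨u, v, rfl⟩ := hz
    obtain ⟨r, hr⟩ := exists_partialA_ellToA j u
    obtain ⟨s, hs⟩ := exists_partialA_ellToA j v
    exact partialA_lie hr.symm hs.symm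
  | zero => simp
  | add a b _ _ ha hb => rw [map_add, map_add, ha, hb, add_zero]
  | smul r a _ ha => rw [map_smul, map_smul, ha, smul_zero]

lemma partialA_mem_below (j : Fin n) {m : ℕ} :
    ∀ a ∈ (filtA n).F m, partialA n j a ∈ below (filtA n).F m := by
  induction m with
  | zero =>
    intro a ha
    obtain ⟨r, rfl⟩ := mem_filtA_zero.1 ha
    rw [partialA_algebraMap]
    exact Submodule.zero_mem _
  | succ m ih =>
    refine filtA_succ_induction ?_ ?_ ?_
    · intro a b ha hb
      rw [map_add]
      exact Submodule.add_mem _ ha hb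
    · intro a ha r
      rw [map_smul]
      refine Submodule.smul_mem _ r ?_
      have := ih a ha
      cases m with
      | zero =>
        rw [(Submodule.mem_bot ℂ).1 this]
        exact Submodule.zero_mem _
      | succ m => exact (filtA n).mono m.le_succ this
    · intro a ha z
      obtain ⟨r, hr⟩ := exists_partialA_ellToA j z
      rw [partialA_mul, ← hr, ← Algebra.commutes, ← Algebra.smul_def]
      exact Submodule.add_mem _ ((filtA n).mul_below_left (ih a ha) (ellToA_mem n z))
        (Submodule.smul_mem (below (filtA n).F (m + 1)) r ha)

/-- The partial derivative acts on `D_{n,i}`. -/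
lemma exists_partialD (hi : 1 ≤ i) (j : Fin n) : ∃ P : D n i →ₗ[ℂ] D n i, P 1 = 0 ∧
    ∀ (z : elln n) (r : ℂ), partialA n j (ellToA n z) = algebraMap ℂ _ r → ∀ y : D n i,
      P (ellToD n i z * y) = r • y + ellToD n i z * P y := by
  -- With truncated subtraction, `F (0 - 1)` is `F 0` rather than `0`, so this is only an inclusion
  -- at `m = 0`.
  have hpred : ∀ m, ∀ a ∈ below (filtA n).F m, a ∈ (filtA n).F (m - 1) := by
    intro m a ha
    cases m with
    | zero =>
      rw [(Submodule.mem_bot ℂ).1 ha]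
      exact Submodule.zero_mem _
    | succ m => exact ha
  have hF : ∀ m, ∀ a ∈ (filtA n).F m, partialA n j a ∈ (filtA n).F (m - 1) :=
    fun m a ha => hpred m _ (partialA_mem_below j a ha)
  obtain ⟨P, hP⟩ := exists_grMap (i := i) hi (partialA n j) (partialA_mul j) (· - 1) hF
    (fun m a ha => partialA_mem_below j a (hpred m a ha))
  refine ⟨P, ?_, ?_⟩
  · rw [← symbolQ_one, hP]
    refine symbolQ_eq_zero _ ?_
    have := partialA_algebraMap j 1
    rw [map_one] at this
    rw [this]
    exact Submodule.zero_mem _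
  · intro z r hr y
    induction y using gr_induction with
    | zero => simp
    | add x y hx hy =>
      rw [mul_add, map_add, hx, hy, map_add, mul_add, smul_add]
      abel
    | symbol m a ha =>
      change P (symbolQ n i 1 (ellToA n z) (ellToA_mem n z) * _) =
        _ + symbolQ n i 1 (ellToA n z) (ellToA_mem n z) * _
      rw [hP, symbolQ_mul, hP, ← symbolQ_smul, symbolQ_mul]
      have e : partialA n j (ellToA n z * a) = r • a + ellToA n z * partialA n j a := by
        rw [partialA_mul, hr, Algebra.smul_def]
      -- For `m = 0` the degree `1 + (0 - 1)` is `1` instead of `0`; the offending term vanishes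
      -- because `a` is a scalar.
      cases m with
      | zero =>
        have h0 : partialA n j a = 0 := (Submodule.mem_bot ℂ).1 (partialA_mem_below j a ha)
        have h1 : symbolQ n i (1 + (0 - 1)) (ellToA n z * partialA n j a)
            ((filtA n).mul_mem (ellToA_mem n z) (hF 0 a ha)) = 0 :=
          (symbolQ_congr rfl (by rw [h0, mul_zero]) _ (Submodule.zero_mem _)).trans
            (symbolQ_eq_zero (a := 0) _ (Submodule.zero_mem _))
        refine (?_ : _ = _).trans ((congrArg _ h1).trans (add_zero _)).symm
        exact symbolQ_congr rfl (by rw [e, h0, mul_zero, add_zero]) _ _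
      | succ m =>
        have h1 : ellToA n z * partialA n j a ∈ (filtA n).F (m + 1) := by
          rw [add_comm]
          exact (filtA n).mul_mem (ellToA_mem n z) (hF _ a ha)
        rw [symbolQ_congr (show 1 + (m + 1 - 1) = m + 1 by omega) rfl _ h1, ← symbolQ_add]
        exact symbolQ_congr (by omega) e _ _

end Partial

/-! ### The algebra `Λ_{n,i}` -/

section Lam

lemma Lam_eq_adjoin : Lam n i =
    Algebra.adjoin ℂ ((ellPrime n).toSubmodule.map (ellToD n i) : Set (D n i)) := by
  apply le_antisymm
  · rintro _ ⟨x, rfl⟩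
    change symPrimeToD n i x ∈ _
    induction x using SymmetricAlgebra.induction with
    | algebraMap r => rw [AlgHom.commutes]; exact Subalgebra.algebraMap_mem _ r
    | ι x =>
      rw [symPrimeToD, SymmetricAlgebra.lift_ι_apply]
      exact Algebra.subset_adjoin ⟨x, x.2, rfl⟩
    | mul a b ha hb => rw [map_mul]; exact Subalgebra.mul_mem _ ha hb
    | add a b ha hb => rw [map_add]; exact Subalgebra.add_mem _ ha hb
  · refine Algebra.adjoin_le ?_
    rintro _ ⟨x, hx, rfl⟩
    exact ⟨SymmetricAlgebra.ι ℂ _ ⟨x, hx⟩, SymmetricAlgebra.lift_ι_apply _ _⟩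

/-- Single brackets, unlike general elements of `ℓ'`, are directly seen to have nilpotent symbols.
-/
lemma Lam_eq_adjoin_lie : Lam n i =
    Algebra.adjoin ℂ (ellToD n i '' {z | ∃ u v : elln n, ⁅u, v⁆ = z}) := by
  rw [Lam_eq_adjoin, ellPrime_eq_span, Submodule.map_span, Algebra.adjoin_span]

lemma ellToD_mem_Lam {z : elln n} (hz : z ∈ (ellPrime n).toSubmodule) : ellToD n i z ∈ Lam n i := by
  rw [Lam_eq_adjoin]
  exact Algebra.subset_adjoin ⟨z, hz, rfl⟩

lemma span_of_sup_ellPrime (n : ℕ) :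
    Submodule.span ℂ (Set.range (FreeLieAlgebra.of ℂ : Fin n → elln n)) ⊔
      (ellPrime n).toSubmodule = ⊤ := by
  let S : LieSubalgebra ℂ (elln n) :=
    { Submodule.span ℂ (Set.range (FreeLieAlgebra.of ℂ : Fin n → elln n)) ⊔
        (ellPrime n).toSubmodule with
      lie_mem' := by
        intro x y _ _
        refine Submodule.mem_sup_right ?_
        rw [ellPrime_eq_span]
        exact Submodule.subset_span ⟨x, y, rfl⟩ }
  have hS : S = ⊤ := freeLieAlgebra_subalgebra_eq_top S fun k =>
    Submodule.mem_sup_left (Submodule.subset_span ⟨k, rfl⟩)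
  rw [eq_top_iff]
  intro z _
  have : z ∈ S := hS ▸ LieSubalgebra.mem_top z
  exact this

lemma ellToA_mem_lowerCentralSeries {k : ℕ} :
    ∀ z ∈ LieModule.lowerCentralSeries ℂ (elln n) (elln n) k,
      ellToA n z ∈ LieModule.lowerCentralSeries ℂ (An n) (An n) k := by
  induction k with
  | zero => simp
  | succ k ih =>
    intro z hz
    rw [LieModule.lowerCentralSeries_succ, ← LieSubmodule.mem_toSubmodule,
      LieSubmodule.lieIdeal_oper_eq_linear_span'] at hz
    induction hz using Submodule.span_induction with
    | mem z hz =>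
      obtain ⟨x, -, y, hy, rfl⟩ := hz
      rw [LieHom.map_lie, Ring.lie_def]
      exact commutator_mem_lowerCentralSeries _ (ih y hy)
    | zero => simp
    | add a b _ _ ha hb => rw [map_add]; exact add_mem ha hb
    | smul r a _ ha => rw [map_smul]; exact SMulMemClass.smul_mem r ha

/-- For `i = k + 1`, the term of index `k` of the lower central series of `ℓ` lands in `M_i`, and it
has a finitely generated supplement `W`. -/
lemma fg_map_ellToD (hi : 1 ≤ i) : ((ellPrime n).toSubmodule.map (ellToD n i)).FG := by
  obtain ⟨k, rfl⟩ := Nat.exists_eq_add_of_le' hi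
  obtain ⟨W, hW, hWk⟩ := exists_fg_sup_lowerCentralSeries
    (Submodule.fg_span (Set.finite_range (FreeLieAlgebra.of ℂ : Fin n → elln n)))
    (span_of_sup_ellPrime n) k
  have hker : (LieModule.lowerCentralSeries ℂ (elln n) (elln n) k).toSubmodule.map
      (ellToD n (k + 1)) = ⊥ := by
    rw [eq_bot_iff]
    rintro _ ⟨z, hz, rfl⟩
    exact symbolQ_eq_zero_of_mem_lowerIdeal (ellToA_mem n z)
      (mem_lowerIdeal (ellToA_mem_lowerCentralSeries z hz))
  have hle : (ellPrime n).toSubmodule.map (ellToD n (k + 1)) ≤ W.map (ellToD n (k + 1)) := by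
    refine (Submodule.map_mono (le_top.trans hWk.ge)).trans ?_
    rw [Submodule.map_sup, hker, sup_bot_eq]
  have : FiniteDimensional ℂ (W.map (ellToD n (k + 1))) := Module.Finite.iff_fg.2 (hW.map _)
  exact Module.Finite.iff_fg.1 (Submodule.finiteDimensional_of_le hle)

lemma isNilpotent_ellToD_lie (hi : 2 ≤ i) (u v : elln n) : IsNilpotent (ellToD n i ⁅u, v⁆) := by
  obtain ⟨k, rfl⟩ := Nat.exists_eq_add_of_le' hi
  refine ⟨2 * k + 1, ?_⟩
  obtain ⟨hk, h⟩ := symbolQ_pow (i := k + 2) (ellToA_mem n ⁅u, v⁆) (2 * k + 1)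
  refine h.trans (symbolQ_eq_zero_of_mem_lowerIdeal _ ?_)
  rw [LieHom.map_lie, Ring.lie_def]
  have : Algebra ℚ (An n) := RestrictScalars.algebra ℚ ℂ (An n)
  exact commutator_pow_mem_lowerIdeal _ _ k

lemma finiteDimensional_Lam (hi : 2 ≤ i) : FiniteDimensional ℂ (Lam n i) := by
  have hfg := fg_map_ellToD (n := n) (by omega : 1 ≤ i)
  -- This selects a finite spanning set consisting of symbols of brackets, so that every generator
  -- is a root of some `X ^ k`.
  rw [ellPrime_eq_span, Submodule.map_span, Submodule.fg_span_iff_fg_span_finset_subset] at hfg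
  obtain ⟨s, hs, hspan⟩ := hfg
  have h : Lam n i = Algebra.adjoin ℂ (s : Set (D n i)) := by
    rw [Lam_eq_adjoin_lie, ← Algebra.adjoin_span, hspan, Algebra.adjoin_span]
  have hfin := Algebra.finite_adjoin_of_finite_of_isIntegral (R := ℂ) s.finite_toSet fun x hx => by
    obtain ⟨_, ⟨u, v, rfl⟩, rfl⟩ := hs hx
    obtain ⟨k, hk⟩ := isNilpotent_ellToD_lie hi u v
    exact ⟨Polynomial.X ^ k, Polynomial.monic_X_pow k, by simp [hk]⟩
  rw [h]
  exact hfin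

lemma nontrivial_D (hi : 2 ≤ i) : Nontrivial (D n i) := by
  refine ⟨1, 0, fun h => ?_⟩
  have h1 : toQ n i 1 = 0 := by
    have := (filtQ n i).mem_below_of_symbol_eq_zero ((filtQ n i).symbol_one.trans h)
    rw [map_one]
    exact (Submodule.mem_bot ℂ).1 this
  have h2 := map_lowerIdeal_two (FreeAlgebra.lift ℂ (0 : Fin n → ℂ)).toRingHom 1
    (lowerIdeal_le_two hi (toQ_eq_zero.1 h1))
  exact one_ne_zero ((map_one _).symm.trans h2)

lemma algebraMap_Lam_injective (hi : 2 ≤ i) : Function.Injective (algebraMap ℂ (Lam n i)) :=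
  have := nontrivial_D (n := n) hi
  (algebraMap ℂ (Lam n i)).injective

lemma mul_mem_degLam {d e : ℕ} {x y : Lam n i} (hx : x ∈ degLam n i d) (hy : y ∈ degLam n i e) :
    x * y ∈ degLam n i (d + e) :=
  mul_mem_degD hx hy

lemma iSupIndep_degLam (hi : 1 ≤ i) : iSupIndep (degLam n i) := by
  intro d
  rw [Submodule.disjoint_def]
  intro x hx hx'
  have h := (Submodule.disjoint_def.1 (iSupIndep_degD (n := n) hi d)) x hx (by
    have := Submodule.mem_map_of_mem (f := (Lam n i).val.toLinearMap) hx'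
    simp only [Submodule.map_iSup] at this
    exact iSup₂_mono (fun e _ => Submodule.map_comap_le _ _) this)
  exact Subtype.ext h

/-- The subalgebra spanned by the scalars and the terms of positive degree of a family of subspaces
that multiply like the pieces of a grading. -/
def scalarsSup {B : Type*} [CommRing B] [Algebra ℂ B] (N : ℕ → Submodule ℂ B)
    (hN : ∀ d e x y, x ∈ N d → y ∈ N e → x * y ∈ N (d + e)) : Subalgebra ℂ B where
  __ := LinearMap.range (Algebra.linearMap ℂ B) ⊔ ⨆ d, N (d + 1)
  algebraMap_mem' := fun r => Submodule.mem_sup_left ⟨r, rfl⟩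
  mul_mem' := by
    have hle : (⨆ d, N (d + 1)) * (⨆ d, N (d + 1)) ≤ ⨆ d, N (d + 1) := by
      rw [Submodule.iSup_mul]
      refine iSup_le fun d => ?_
      rw [Submodule.mul_iSup]
      refine iSup_le fun e => Submodule.mul_le.2 fun x hx y hy => ?_
      have h := hN _ _ x y hx hy
      exact Submodule.mem_iSup_of_mem (d + 1 + e) h
    intro x y hx hy
    obtain ⟨_, ⟨r, rfl⟩, u, hu, rfl⟩ := Submodule.mem_sup.1 hx
    obtain ⟨_, ⟨s, rfl⟩, v, hv, rfl⟩ := Submodule.mem_sup.1 hy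
    refine Submodule.mem_sup.2 ⟨_, ⟨r * s, rfl⟩, r • v + s • u + u * v,
      Submodule.add_mem _ (Submodule.add_mem _ (Submodule.smul_mem _ r hv)
        (Submodule.smul_mem _ s hu)) (hle (Submodule.mul_mem_mul hu hv)), ?_⟩
    simp only [Algebra.linearMap_apply, map_mul, Algebra.smul_def]
    ring

/-- By bilinearity `u` and `v` may be taken homogeneous of positive degree. -/
lemma ellToD_lie_mem_iSup_degLam (u v : elln n) :
    ellToD n i ⁅u, v⁆ ∈ (⨆ d, degLam n i (d + 1)).map (Lam n i).val.toLinearMap := by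
  have hu : u ∈ Submodule.span ℂ {z : elln n | ∃ d, ellToA n z ∈ degA n (d + 1)} := by
    rw [elln_eq_span]
    trivial
  have hv : v ∈ Submodule.span ℂ {z : elln n | ∃ d, ellToA n z ∈ degA n (d + 1)} := by
    rw [elln_eq_span]
    trivial
  induction hu, hv using Submodule.span_induction₂ with
  | mem_mem x y hx hy =>
    obtain ⟨d, hd⟩ := hx
    obtain ⟨e, he⟩ := hy
    have hxy : ⁅x, y⁆ ∈ (ellPrime n).toSubmodule := by
      rw [ellPrime_eq_span]
      exact Submodule.subset_span ⟨x, y, rfl⟩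
    refine ⟨⟨_, ellToD_mem_Lam hxy⟩, Submodule.mem_iSup_of_mem (d + 1 + e) ?_, rfl⟩
    have h := lie_mem_degA hd he
    exact ellToD_mem_degD h
  | zero_left y _ => simp
  | zero_right x _ => simp
  | add_left x y z _ _ _ h h' => rw [add_lie, map_add]; exact Submodule.add_mem _ h h'
  | add_right x y z _ _ _ h h' => rw [lie_add, map_add]; exact Submodule.add_mem _ h h'
  | smul_left r x y _ _ h => rw [smul_lie, map_smul]; exact Submodule.smul_mem _ r h
  | smul_right r x y _ _ h => rw [lie_smul, map_smul]; exact Submodule.smul_mem _ r h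

/-- `Λ_{n,i}` is spanned by scalars and homogeneous elements of positive degree. -/
lemma range_sup_iSup_degLam :
    LinearMap.range (Algebra.linearMap ℂ (Lam n i)) ⊔ ⨆ d, degLam n i (d + 1) = ⊤ := by
  have hS : Lam n i ≤ (scalarsSup (degLam n i) fun _ _ _ _ => mul_mem_degLam).map (Lam n i).val := by
    conv_lhs => rw [Lam_eq_adjoin_lie]
    refine Algebra.adjoin_le ?_
    rintro _ ⟨_, ⟨u, v, rfl⟩, rfl⟩
    obtain ⟨x, hx, hxu⟩ := ellToD_lie_mem_iSup_degLam (i := i) u v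
    exact ⟨x, Submodule.mem_sup_right hx, hxu⟩
  rw [eq_top_iff]
  intro x _
  obtain ⟨y, hy, hyx⟩ := hS x.2
  have : y = x := Subtype.ext hyx
  exact this ▸ hy

lemma range_le_degLam_zero :
    LinearMap.range (Algebra.linearMap ℂ (Lam n i)) ≤ degLam n i 0 := by
  rintro _ ⟨r, rfl⟩
  exact algebraMap_mem_degD r

lemma iSup_degLam : ⨆ d, degLam n i d = ⊤ := by
  rw [eq_top_iff, ← range_sup_iSup_degLam]
  exact sup_le (range_le_degLam_zero.trans (le_iSup _ 0))
    (iSup_le fun d => le_iSup (degLam n i) (d + 1))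

lemma degLam_zero (hi : 1 ≤ i) :
    degLam n i 0 = LinearMap.range (Algebra.linearMap ℂ (Lam n i)) := by
  refine le_antisymm (fun x hx => ?_) range_le_degLam_zero
  have hx' : x ∈ LinearMap.range (Algebra.linearMap ℂ (Lam n i)) ⊔ ⨆ d, degLam n i (d + 1) := by
    rw [range_sup_iSup_degLam]
    trivial
  obtain ⟨y, hy, z, hz, rfl⟩ := Submodule.mem_sup.1 hx'
  have hz0 : z ∈ degLam n i 0 := (Submodule.add_mem_iff_right _ (range_le_degLam_zero hy)).1 hx
  have : z = 0 := (Submodule.disjoint_def.1 (iSupIndep_degLam (n := n) hi 0)) z hz0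
    ((iSup_le fun d => le_iSup₂_of_le (f := fun e (_ : e ≠ 0) => degLam n i e) (d + 1)
      d.succ_ne_zero le_rfl : ⨆ d, degLam n i (d + 1) ≤ _) hz)
  rwa [this, add_zero]

lemma nonempty_gradedAlgebra_degLam (hi : 1 ≤ i) : Nonempty (GradedAlgebra (degLam n i)) := by
  have hint : DirectSum.IsInternal (degLam n i) :=
    (DirectSum.isInternal_submodule_iff_iSupIndep_and_iSup_eq_top _).2
      ⟨iSupIndep_degLam hi, iSup_degLam⟩
  exact ⟨{ hint.chooseDecomposition with
    one_mem := range_le_degLam_zero ⟨1, (algebraMap ℂ (Lam n i)).map_one⟩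
    mul_mem := fun _ _ _ _ hx hy => mul_mem_degLam hx hy }⟩

end Lam


/-! ### The map `θ` -/

section Theta

/-- A polynomial `p` vanishes if it lies in a subspace `K` stable under partial derivatives which
contains no non-zero constant. -/
lemma eq_zero_of_pderiv_stable {σ B : Type*} [CommRing B] [Algebra ℚ B]
    (K : Set (MvPolynomial σ B)) (hK : ∀ j, ∀ p ∈ K, MvPolynomial.pderiv j p ∈ K)
    (hC : ∀ b, MvPolynomial.C b ∈ K → b = 0) : ∀ p ∈ K, p = 0 := by
  classical
  -- Induction on a strict bound `N` for the degree, which each partial derivative lowers by one.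
  have key : ∀ N : ℕ, ∀ p ∈ K, (∀ m : σ →₀ ℕ, N ≤ m.degree → p.coeff m = 0) → p = 0 := by
    intro N
    induction N with
    | zero =>
      intro p _ h
      ext m
      simpa using h m (Nat.zero_le _)
    | succ N ih =>
      intro p hp h
      have hd : ∀ j, MvPolynomial.pderiv j p = 0 := by
        intro j
        refine ih _ (hK j p hp) fun m hm => ?_
        rw [MvPolynomial.coeff_pderiv, h, zero_mul]
        rw [map_add, Finsupp.degree_single]
        omega
      -- If `m j ≠ 0`, the coefficient of `∂_j p` at `m - e_j` is `m j` times that of `p` at `m`,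
      -- and `m j` is invertible over `ℚ`.
      have hc : p = MvPolynomial.C (p.coeff 0) := by
        ext m
        rw [MvPolynomial.coeff_C]
        split_ifs with hm
        · rw [hm]
        · obtain ⟨j, hj⟩ : ∃ j, m j ≠ 0 := by
            by_contra! hcon
            exact hm (Finsupp.ext hcon).symm
          have hm' : m - Finsupp.single j 1 + Finsupp.single j 1 = m :=
            tsub_add_cancel_of_le (by simpa [Nat.one_le_iff_ne_zero] using hj)
          have h0 := MvPolynomial.coeff_pderiv (i := j) p (m - Finsupp.single j 1)
          rw [hd j, MvPolynomial.coeff_zero, hm'] at h0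
          generalize (m - Finsupp.single j 1 : σ →₀ ℕ) j = k at h0
          have hunit : IsUnit ((k : B) + 1) := by
            have : ((k : ℚ) + 1) ≠ 0 := by positivity
            simpa using this.isUnit.map (algebraMap ℚ B)
          exact (hunit.mul_left_eq_zero).1 h0.symm
      rw [hc] at hp ⊢
      rw [hC _ hp, map_zero]
  intro p hp
  exact key (p.totalDegree + 1) p hp fun m hm =>
    MvPolynomial.coeff_eq_zero_of_totalDegree_lt (by
      rw [← Finsupp.degree_apply]
      omega)

/-- The multiplication map, as a homomorphism from the polynomial ring over `Λ_{n,i}`. -/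
def thetaPoly (n i : ℕ) : MvPolynomial (Fin n) (Lam n i) →ₐ[Lam n i] D n i :=
  MvPolynomial.aeval fun j => ellToD n i (FreeLieAlgebra.of ℂ j)

/-- The tensor product `ℂ[x_1, …, x_n] ⊗ Λ_{n,i}` as a polynomial ring over `Λ_{n,i}`. -/
def tensorLamEquiv (n i : ℕ) :
    TensorProduct ℂ (MvPolynomial (Fin n) ℂ) (Lam n i) ≃ₐ[ℂ] MvPolynomial (Fin n) (Lam n i) :=
  (Algebra.TensorProduct.comm ℂ _ _).trans
    ((MvPolynomial.algebraTensorAlgEquiv ℂ (Lam n i)).restrictScalars ℂ)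

lemma theta_eq (t : TensorProduct ℂ (MvPolynomial (Fin n) ℂ) (Lam n i)) :
    theta n i t = thetaPoly n i (tensorLamEquiv n i t) := by
  induction t using TensorProduct.induction_on with
  | zero => simp
  | add x y hx hy => rw [map_add, map_add, map_add, hx, hy]
  | tmul p x =>
    have h1 : tensorLamEquiv n i (p ⊗ₜ x) = x • MvPolynomial.map (algebraMap ℂ (Lam n i)) p := by
      simp [tensorLamEquiv]
    rw [h1, map_smul, thetaPoly, MvPolynomial.aeval_map_algebraMap, theta,
      Algebra.TensorProduct.productMap_apply_tmul, mul_comm]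
    rfl

lemma map_Lam_mul {P : D n i →ₗ[ℂ] D n i} (h : ∀ z ∈ (ellPrime n).toSubmodule, ∀ y,
    P (ellToD n i z * y) = ellToD n i z * P y) {x : D n i} (hx : x ∈ Lam n i) (y : D n i) :
    P (x * y) = x * P y := by
  rw [Lam_eq_adjoin] at hx
  induction hx using Algebra.adjoin_induction generalizing y with
  | mem x hx =>
    obtain ⟨z, hz, rfl⟩ := hx
    exact h z hz y
  | algebraMap r => rw [← Algebra.smul_def, map_smul, Algebra.smul_def]
  | add a b _ _ ha hb => rw [add_mul, map_add, ha, hb, add_mul]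
  | mul a b _ _ ha hb => rw [mul_assoc, ha, hb, mul_assoc]

/-- The operator induced by `∂/∂x_j` is `Λ`-linear, since `∂/∂x_j` kills `ℓ'`, and it obeys the
Leibniz rule for multiplication by each `x_k`. -/
lemma exists_partialD_thetaPoly (hi : 1 ≤ i) (j : Fin n) : ∃ P : D n i →ₗ[ℂ] D n i,
    ∀ p, P (thetaPoly n i p) = thetaPoly n i (MvPolynomial.pderiv j p) := by
  obtain ⟨P, hP1, hP⟩ := exists_partialD (n := n) hi j
  have hL : ∀ x : Lam n i, ∀ y, P (x * y) = x * P y := fun x y =>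
    map_Lam_mul (fun z hz y => by
      have := hP z 0 (by rw [map_zero]; exact partialA_ellPrime j hz) y
      rwa [zero_smul, zero_add] at this) x.2 y
  refine ⟨P, fun p => ?_⟩
  induction p using MvPolynomial.induction_on with
  | C x =>
    have := hL x 1
    rw [hP1, mul_zero, mul_one] at this
    rw [MvPolynomial.pderiv_C, map_zero, thetaPoly, MvPolynomial.aeval_C]
    exact this
  | add p q hp hq => simp only [map_add, hp, hq]
  | mul_X p k hp =>
    have hX : thetaPoly n i (MvPolynomial.X k) = ellToD n i (FreeLieAlgebra.of ℂ k) :=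
      MvPolynomial.aeval_X _ _
    rw [map_mul, hX, mul_comm, hP _ _ (partialA_of j k), hp, MvPolynomial.pderiv_mul, map_add,
      map_mul, map_mul, hX, MvPolynomial.pderiv_X]
    by_cases h : k = j
    · subst h
      simp only [Pi.single_eq_same, one_smul, map_one, mul_one]
      ring
    · simp only [Pi.single_eq_of_ne h, zero_smul, map_zero,
        mul_zero, add_zero, zero_add]
      ring

lemma thetaPoly_injective (hi : 1 ≤ i) : Function.Injective (thetaPoly n i) := by
  have : Algebra ℚ (Lam n i) := RestrictScalars.algebra ℚ ℂ (Lam n i)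
  refine (injective_iff_map_eq_zero _).2 fun p hp =>
    eq_zero_of_pderiv_stable {p | thetaPoly n i p = 0} ?_ ?_ p hp
  · intro j p hp
    obtain ⟨P, hP⟩ := exists_partialD_thetaPoly (n := n) hi j
    have hp' : thetaPoly n i p = 0 := hp
    have := hP p
    rw [hp', map_zero] at this
    exact this.symm
  · intro x hx
    have : thetaPoly n i (MvPolynomial.C x) = 0 := hx
    rw [thetaPoly, MvPolynomial.aeval_C] at this
    exact Subtype.ext this

lemma ellToD_mem_range_theta (z : elln n) : ellToD n i z ∈ (theta n i).range := by
  have hz : z ∈ Submodule.span ℂ (Set.range (FreeLieAlgebra.of ℂ : Fin n → elln n)) ⊔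
      (ellPrime n).toSubmodule := by
    rw [span_of_sup_ellPrime]
    trivial
  obtain ⟨x, hx, y, hy, rfl⟩ := Submodule.mem_sup.1 hz
  rw [map_add]
  refine Subalgebra.add_mem _ ?_ ⟨1 ⊗ₜ ⟨_, ellToD_mem_Lam hy⟩, ?_⟩
  · clear hz
    induction hx using Submodule.span_induction with
    | mem x hx =>
      obtain ⟨j, rfl⟩ := hx
      refine ⟨MvPolynomial.X j ⊗ₜ 1, ?_⟩
      simp [theta]
    | zero => rw [map_zero]; exact Subalgebra.zero_mem _
    | add a b _ _ ha hb => rw [map_add]; exact Subalgebra.add_mem _ ha hb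
    | smul r a _ ha => rw [map_smul]; exact (theta n i).range.smul_mem ha r
  · simp [theta]

lemma theta_surjective : Function.Surjective (theta n i) := by
  suffices h : ∀ m, ∀ a ∈ (filtA n).F m, ∀ ha, symbolQ n i m a ha ∈ (theta n i).range from
    fun y => gr_induction (p := (· ∈ (theta n i).range)) (Subalgebra.zero_mem _)
      (fun _ _ => Subalgebra.add_mem _) (fun m a ha => h m a ha ha) y
  intro m
  induction m with
  | zero =>
    intro a ha _
    obtain ⟨r, rfl⟩ := mem_filtA_zero.1 ha
    rw [symbolQ_algebraMap]
    exact Subalgebra.algebraMap_mem _ r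
  | succ m ih =>
    -- The membership proof is existentially quantified so that the claim is a predicate of `a`
    -- alone, as `filtA_succ_induction` requires.
    have : ∀ a ∈ (filtA n).F (m + 1), ∃ ha, symbolQ n i (m + 1) a ha ∈ (theta n i).range := by
      refine filtA_succ_induction ?_ ?_ ?_
      · rintro a b ⟨ha, ha'⟩ ⟨hb, hb'⟩
        refine ⟨Submodule.add_mem _ ha hb, ?_⟩
        rw [symbolQ_add ha hb]
        exact Subalgebra.add_mem _ ha' hb'
      · intro a ha r
        have hr : r • a ∈ below (filtA n).F (m + 1) := Submodule.smul_mem ((filtA n).F m) r ha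
        refine ⟨(filtA n).mono m.le_succ hr, ?_⟩
        rw [symbolQ_eq_zero _ hr]
        exact Subalgebra.zero_mem _
      · intro a ha z
        refine ⟨(filtA n).mul_mem ha (ellToA_mem n z), ?_⟩
        rw [← symbolQ_mul ha (ellToA_mem n z)]
        exact Subalgebra.mul_mem _ (ih a ha ha) (ellToD_mem_range_theta z)
    intro a ha _
    exact (this a ha).2

lemma theta_bijective (hi : 1 ≤ i) : Function.Bijective (theta n i) := by
  refine ⟨?_, theta_surjective⟩
  have h : ⇑(theta n i) = thetaPoly n i ∘ tensorLamEquiv n i := funext theta_eq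
  rw [h]
  exact (thetaPoly_injective hi).comp (tensorLamEquiv n i).injective

end Theta

end LieNilp

end

theorem theorem2p1 (n i : ℕ) (hn : 2 ≤ n) (hi : 2 ≤ i) :
    (FiniteDimensional ℂ (LieNilp.Lam n i) ∧
      Nonempty (GradedAlgebra (LieNilp.degLam n i)) ∧
      Function.Injective (algebraMap ℂ (LieNilp.Lam n i)) ∧
      LieNilp.degLam n i 0 = LinearMap.range (Algebra.linearMap ℂ (LieNilp.Lam n i))) ∧
    Function.Bijective (LieNilp.theta n i) := by
  have hi' : 1 ≤ i := by omega
  exact ⟨⟨LieNilp.finiteDimensional_Lam hi, LieNilp.nonempty_gradedAlgebra_degLam hi',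
    LieNilp.algebraMap_Lam_injective hi, LieNilp.degLam_zero hi'⟩, LieNilp.theta_bijective hi'⟩
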